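/- **Proposition 6 (Kovalevskaya case, differential forms).** Let $a\in\mathbb R$, $a\neq 0$, and let $X$ be the Kovalevskaya vector field on $\mathbb R^6$ with coordinates $(\gamma_1,\gamma_2,\gamma_3,M_1,M_2,M_3)$, i.e. the vector field of the system \[\dot\gamma_1=2\gamma_3M_2-4\gamma_2M_3,\quad \dot\gamma_2=-2\gamma_3M_1+4\gamma_1M_3,\quad \dot\gamma_3=2\gamma_2M_1-2\gamma_1M_2,\] \[\dot M_1=-2M_2M_3,\quad \dot M_2=2M_1M_3-a\gamma_3,\quad \dot M_3=a\gamma_2,\] with the first integrals \[f_1=\gamma_1^2+\gamma_2^2+\gamma_3^2,\quad f_2=\gamma_1M_1+\gamma_2M_2+\gamma_3M_3,\quad f_3=M_1^2+M_2^2+2M_3^2+a\gamma_1,\] \[f_4=(M_1^2-M_2^2-a\gamma_1)^2+(2M_1M_2-a\gamma_2)^2 .\] For every $C^2$ function $g$ on $\mathbb R^4$ the 1-form $dg(f_1,\ldots,f_4)$ is invariant under $X$. Moreover, let $q\in\{2,3\}$. Then: 1. for all $C^2$ functions $g_1,\ldots,g_q$ on $\mathbb R^4$, the tensor field $dg_1(f_1,\ldots,f_4)\otimes\cdots\otimes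 dg_q(f_1,\ldots,f_4)$ satisfies the invariance equation $\mathcal L_XT=0$; 2. a tensor field $T$ of type $(0,q)$ on $\mathbb R^6$ (no symmetry assumed) whose components are real polynomials of degree at most $3$ in the coordinates satisfies $\mathcal L_XT=0$ if and only if it is a finite real linear combination of tensor products $dg_1(f_1,\ldots,f_4)\otimes\cdots\otimes dg_q(f_1,\ldots,f_4)$ with smooth functions $g_k$ on $\mathbb R^4$; 3. if such a solution $T$ of $\mathcal L_XT=0$ is moreover totally antisymmetric (a differential $q$-form), then it is a single exterior product $T=dg_1(f_1,\ldots,f_4)\wedge\cdots\wedge dg_q(f_1,\ldots,f_4)$ with smooth functions $g_k$ on $\mathbb R^4$. -/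

import Mathlib

open scoped ContDiff

namespace Kovalevskaya

/-- The partial derivative `∂f/∂xⁱ` of a real function on `ℝⁿ`. -/
noncomputable def partialDeriv {n : ℕ} (i : Fin n) (f : (Fin n → ℝ) → ℝ) (x : Fin n → ℝ) : ℝ :=
  fderiv ℝ f x (Pi.single i 1)

/-- A tensor field of type `(0,q)` on `ℝⁿ`, given by its components: `T J x` is the component
`T_{j₁…j_q}` at the point `x`, where `J = (j₁,…,j_q)`. No symmetry in the indices is assumed. -/
abbrev CovTensorField (n q : ℕ) : Type := (Fin q → Fin n) → (Fin n → ℝ) → ℝ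

/-- The Lie derivative of a tensor field of type `(0,q)` along the vector field `X`:
`(L_X T)_{j₁…j_q} = ∑ₖ Xᵏ ∂ₖ T_{j₁…j_q} + ∑ₛ ∑ₘ (∂_{jₛ} Xᵐ) T_{j₁…m…j_q}` (`m` in position `s`). -/
noncomputable def lieDeriv {n q : ℕ} (X : (Fin n → ℝ) → (Fin n → ℝ)) (T : CovTensorField n q) :
    CovTensorField n q :=
  fun J x => ∑ k, X x k * partialDeriv k (T J) x
    + ∑ s, ∑ m, partialDeriv (J s) (fun y => X y m) x * T (Function.update J s m) x

/-- The invariance equation `L_X T = 0`, on all of `ℝⁿ`. -/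
def IsInvariant {n q : ℕ} (X : (Fin n → ℝ) → (Fin n → ℝ)) (T : CovTensorField n q) : Prop :=
  ∀ J x, lieDeriv X T J x = 0

/-- Every component is a (not necessarily homogeneous) real polynomial of degree at most three in
the coordinates. -/
def HasCubicComponents {n q : ℕ} (T : CovTensorField n q) : Prop :=
  ∀ J, ∃ p : MvPolynomial (Fin n) ℝ, p.totalDegree ≤ 3 ∧ ∀ x, T J x = MvPolynomial.eval x p

/-- `T` is totally antisymmetric, i.e. a differential `q`-form in the strict sense. -/
def IsAlternating {n q : ℕ} (T : CovTensorField n q) : Prop :=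
  ∀ (σ : Equiv.Perm (Fin q)) (J : Fin q → Fin n) (x : Fin n → ℝ),
    T (J ∘ σ) x = ((Equiv.Perm.sign σ : ℤ) : ℝ) * T J x

/-- The tensor product `dG₁ ⊗ ⋯ ⊗ dG_q` of differentials of functions. -/
noncomputable def tensorDiff {n q : ℕ} (G : Fin q → (Fin n → ℝ) → ℝ) : CovTensorField n q :=
  fun J x => ∏ s, partialDeriv (J s) (G s) x

/-- The exterior product `dG₁ ∧ ⋯ ∧ dG_q`, with components `det (∂_{jₛ} G_t)_{s,t}`. -/
noncomputable def wedgeDiff {n q : ℕ} (G : Fin q → (Fin n → ℝ) → ℝ) : CovTensorField n q :=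
  fun J x => Matrix.det (Matrix.of fun s t => partialDeriv (J s) (G t) x)

/-- The Kovalevskaya vector field on `ℝ⁶` with coordinates
`(x 0, x 1, x 2, x 3, x 4, x 5) = (γ₁, γ₂, γ₃, M₁, M₂, M₃)`. -/
def field (a : ℝ) (x : Fin 6 → ℝ) : Fin 6 → ℝ :=
  ![2 * x 2 * x 4 - 4 * x 1 * x 5,
    -2 * x 2 * x 3 + 4 * x 0 * x 5,
    2 * x 1 * x 3 - 2 * x 0 * x 4,
    -2 * x 4 * x 5,
    2 * x 3 * x 5 - a * x 2,
    a * x 1]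

/-- The four first integrals `(f₁, f₂, f₃, f₄)` of the Kovalevskaya top. -/
def integrals (a : ℝ) (x : Fin 6 → ℝ) : Fin 4 → ℝ :=
  ![x 0 ^ 2 + x 1 ^ 2 + x 2 ^ 2,
    x 0 * x 3 + x 1 * x 4 + x 2 * x 5,
    x 3 ^ 2 + x 4 ^ 2 + 2 * x 5 ^ 2 + a * x 0,
    (x 3 ^ 2 - x 4 ^ 2 - a * x 0) ^ 2 + (2 * x 3 * x 4 - a * x 1) ^ 2]

/-- The tensor products `d g₁(f₁,…,f₄) ⊗ ⋯ ⊗ d g_q(f₁,…,f₄)` with smooth `g₁, …, g_q` on `ℝ⁴`. -/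
def invariantProducts (a : ℝ) (q : ℕ) : Set (CovTensorField 6 q) :=
  {T | ∃ g : Fin q → (Fin 4 → ℝ) → ℝ, (∀ s, ContDiff ℝ ∞ (g s)) ∧
    T = tensorDiff fun s x => g s (integrals a x)}

end Kovalevskaya

/-! The invariance of products of differentials is formal: `L_X dh = d(Xh)`, which vanishes for a
first integral `h`, and `L_X` obeys the Leibniz rule for tensor products (`isInvariant_tensorDiff`).
The content is the converse: every invariant `T` with cubic components is a constant coefficient
combination of the products `df_{i₁} ⊗ ⋯ ⊗ df_{i_q}` with all `i ≤ 3`. The integral `f₄` does not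
occur, since the components of `df₄` are already cubic.

For cubic components, `L_X T = 0` is a finite homogeneous linear system in the coefficients of `T`.
The products of `df₁, df₂, df₃` give `3^q` solutions. There are `3^q` coefficients, one for each
product, such that each is nonzero in its own product and zero in all the others
(`coeff_productPoly`). Subtracting a combination of products makes these coefficients zero, and it
remains to show that the system so normalised has only the zero solution (`eq_zero_of_polyLie`).

The substitution `γ ↦ aγ` reduces the system to `a = 1` (`scaled_equation`), where it has integer
coefficients and makes sense in any abelian group (`System`). A real solution takes values in a
finitely generated torsion-free group, which integer functionals separate, so integer solutions
suffice (`System.eq_zero`). An integer solution that vanishes modulo 3 can be divided by 3 and is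
again a solution, so by descent it suffices to work over the field with three elements
(`System.eq_zero_int`). All quadratic terms of the field have even coefficients, so 2 would be a
poor choice of prime.

Over that field the claim is a finite computation. A grading modulo 26 splits the system into
independent classes. For each class the program `solve` generates the equations and eliminates; its
soundness (`eq_zero_of_solve`) is proved and its runs are evaluated by the kernel (`solve_eq_true`).
Soundness needs only that each row used is a true equation: losing rows can make a run fail but
never makes it wrong.

For the antisymmetric case, antisymmetrising the combination turns tensor products into
determinants. A 2-vector in a space of dimension 3 is decomposable, and a 3-vector there is a
multiple of the basic one. -/

namespace Kovalevskaya

/-! ### Linear algebra over the field with three elements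

A row is a pair `(p, n)` of natural numbers: bit `i` of `p` (of `n`) is set when the coefficient of
the unknown `i` is `1` (is `-1`). The first 64 unknowns are zero by convention; they only give rows
distinct hash values. Everything is written with recursors and in continuation passing style, so that
the kernel evaluates it without blow-up. -/

namespace Ternary

/-- A list of rows. -/
inductive Rows
  | nil
  | cons (p n : Nat) (r : Rows)

/-- A search tree for the pivot rows, ordered by `b % 2131` with `b` the pivot bit. -/
inductive Tree
  | leaf
  | tip (p n : Nat)
  | node (m : Nat) (a b : Tree)

/-- The state of an elimination: the mask `u` of undetermined unknowns, the mask `v` of pivots, the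
mask `f` of unknowns that are neither, the pivot rows `t`, and the same rows in order `s`. -/
structure State where
  u : Nat
  v : Nat
  f : Nat
  t : Tree
  s : Rows

/-- Evaluate `n` before passing it on. -/
noncomputable def force (n : Nat) (k : Nat → Bool) : Bool :=
  Nat.rec (k 0) (fun m _ => k (Nat.succ m)) n

noncomputable def ifZero (n : Nat) (a b : Bool) : Bool := Bool.rec b a (Nat.beq n 0)

noncomputable def find (t : Tree) (j : Nat) (k : Nat → Nat → Bool) (d : Bool) : Bool :=
  Tree.rec d (fun p n => k p n) (fun m _ _ ha hb => Bool.rec hb ha (Nat.ble j m)) t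

/-- A row already stored at the same place is overwritten. Two pivots with the same residue would
thus cost a row, which affects only the success of a run. -/
noncomputable def insert (t : Tree) (j p n : Nat) (k : Tree → Bool) : Bool :=
  Tree.rec (motive := fun _ => (Tree → Bool) → Bool) (fun k => k (.tip p n))
    (fun _ _ k => k (.tip p n))
    (fun m a b ha hb k => Bool.rec (hb fun b => k (.node m a b)) (ha fun a => k (.node m a b))
      (Nat.ble j m)) t k

noncomputable def blank (d : Nat) : Nat → Tree :=
  Nat.rec (fun _ => .leaf)
    (fun d ih lo => .node (Nat.sub (Nat.add lo (Nat.pow 2 d)) 1) (ih lo)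
      (ih (Nat.add lo (Nat.pow 2 d)))) d

/-- The sum of two rows. -/
noncomputable def add (p n p' n' : Nat) (k : Nat → Nat → Bool) : Bool :=
  force (Nat.xor (Nat.lor p p') (Nat.lor n n')) fun t =>
    force (Nat.land t (Nat.lor (Nat.xor p p') (Nat.land n n'))) fun q =>
      force (Nat.xor t q) fun r => k q r

/-- The lowest bit. -/
noncomputable def low (s : Nat) : Nat := Nat.land s (Nat.xor s (Nat.sub s 1))

/-- Eliminate the pivots `v` from a row. -/
noncomputable def subst (fuel : Nat) (t : Tree) (v p n : Nat) (k : Nat → Nat → Bool) : Bool :=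
  Nat.rec (motive := fun _ => Nat → Nat → Bool) k
    (fun _ ih p n => (fun s => ifZero s (k p n)
      (force (low s) fun b => find t (Nat.mod b 2131) (fun p' n' =>
        ifZero (Nat.land (Nat.shiftRight p 64) b) (add p n p' n' ih) (add p n n' p' ih)) (k p n)))
      (Nat.shiftRight (Nat.land (Nat.lor p n) v) 64)) fuel p n

/-- Whether at most `c` bits of `x` are set. -/
noncomputable def atMost (c x : Nat) : Bool :=
  Nat.rec (motive := fun _ => Nat → Bool) (fun x => Nat.beq x 0)
    (fun _ ih x => ifZero x true (ih (Nat.land x (Nat.sub x 1)))) c x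

/-- Reduce a row and use it as a pivot row, unless it is longer than `c`. -/
noncomputable def step (c : Nat) (st : State) (p n : Nat) (keep : Nat → Nat → Bool)
    (done k : State → Bool) : Bool :=
  State.rec (fun u v f t s =>
    Bool.rec (keep p n)
      (subst 5000 t v p n fun p n => force (Nat.land p u) fun p => force (Nat.land n u) fun n =>
        (fun x => ifZero x (k (.mk u v f t s))
          (Bool.rec (keep p n)
            (force (low x) fun b => force (Nat.mod b 2131) fun j =>
              force (Nat.xor (Nat.shiftLeft b 64) j) fun b' =>
              force (Nat.xor f b') fun f =>
              ifZero (Nat.land x (Nat.sub x 1))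
                (force (Nat.xor u b') fun u =>
                  ifZero (Nat.shiftRight f 64) (done (.mk u v f t s)) (k (.mk u v f t s)))
                (force (Nat.lor v b') fun v => ifZero (Nat.land (Nat.shiftRight p 64) b)
                  (insert t j n p fun t => ifZero (Nat.shiftRight f 64)
                    (done (.mk u v f t (.cons p n s))) (k (.mk u v f t (.cons p n s))))
                  (insert t j p n fun t => ifZero (Nat.shiftRight f 64)
                    (done (.mk u v f t (.cons p n s))) (k (.mk u v f t (.cons p n s))))))
            (atMost c x))) (Nat.shiftRight (Nat.lor p n) 64))
      (atMost c (Nat.shiftRight (Nat.land (Nat.lor p n) f) 64))) st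

noncomputable def pass (c : Nat) (rows : Rows) (st : State) (kept : Rows) (done : State → Bool)
    (k : State → Rows → Bool) : Bool :=
  Rows.rec (motive := fun _ => State → Rows → Bool) k
    (fun p n _ ih st kept =>
      step c st p n (fun p n => ih st (.cons p n kept)) done (fun st => ih st kept)) rows st kept

noncomputable def passes (cs : List Nat) (rows : Rows) (st : State) (done : State → Bool) : Bool :=
  List.rec (motive := fun _ => Rows → State → Bool) (fun _ st => done st)
    (fun c _ ih rows st => pass c rows st .nil done fun st rows => ih rows st) cs rows st

/-- Pivot rows are visited from the newest to the oldest: a pivot row has been reduced by the older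
ones, so besides its own pivot it should contain only newer pivots, which are by then known to
vanish. -/
noncomputable def backSubst (s : Rows) (u : Nat) : Bool :=
  Rows.rec (motive := fun _ => Nat → Bool) (fun u => Nat.beq (Nat.shiftRight u 64) 0)
    (fun p n _ ih u => (fun x => ifZero (Nat.land x (Nat.sub x 1))
      (force (Nat.xor u (Nat.xor (Nat.shiftLeft x 64) (Nat.mod x 2131))) ih) (ih u))
      (Nat.shiftRight (Nat.land (Nat.lor p n) u) 64)) s u

/-- Whether elimination, in passes with the length bounds `cs`, shows that the unknowns in the mask
`u` vanish. -/
noncomputable def eliminate (cs : List Nat) (rows : Rows) (u : Nat) : Bool :=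
  -- Depth 12 gives `2 ^ 12` places, enough for all residues modulo 2131.
  force u fun u => passes cs rows (.mk u 0 u (blank 12 0) .nil)
    fun st => State.rec (fun u _ _ _ s => backSubst s u) st

end Ternary

/-! ### The equations

A monomial in the six coordinates is coded by the number whose base 5 digits are its exponents. -/

/-- The terms `c xᵢ xⱼ ∂ₖ` of the vector field, as `(k, i, j, c)`. -/
def quadTerms : List (Nat × Nat × Nat × Int) :=
  [(0, 2, 4, 2), (0, 1, 5, -4), (1, 2, 3, -2), (1, 0, 5, 4), (2, 1, 3, 2), (2, 0, 4, -2),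
    (3, 4, 5, -2), (4, 3, 5, 2)]

/-- The terms `c a xᵢ ∂ₖ` of the vector field, as `(k, i, c)`. -/
def linTerms : List (Nat × Nat × Int) := [(4, 2, -1), (5, 1, 1)]

/-- For each slot digit the terms `c xᵢ` of `∂ⱼXᵐ`; the digit `d` stands for coordinate `5 - d`, and
`i = 6` for a constant term. -/
def slotTerms : Nat → List (Nat × Nat × Int)
  | 0 => [(5, 1, -4), (4, 0, 4), (2, 4, -2), (1, 3, 2)]
  | 1 => [(5, 2, 2), (3, 0, -2), (2, 5, -2)]
  | 2 => [(4, 2, -2), (3, 1, 2), (1, 5, 2)]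
  | 3 => [(5, 4, 2), (4, 3, -2), (1, 6, -1)]
  | 4 => [(5, 5, -4), (3, 3, 2), (0, 6, 1)]
  | _ => [(4, 5, 4), (3, 4, -2)]

def digit (r i : Nat) : Nat := Nat.mod (Nat.div r (Nat.pow 5 i)) 5
/-- The digit of the slot code `J` at the slot `s`. -/
def slot (J s : Nat) : Nat := Nat.mod (Nat.div J (Nat.pow 6 s)) 6

/-- The codes of the monomials of degree at most `d` in `v` variables. -/
def monomials : Nat → Nat → List Nat
  | 0, _ => [0]
  | v + 1, d => (List.range (d + 1)).flatMap fun a =>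
      (monomials v (d - a)).map fun r => a + 5 * r

/-- A grading for which the vector field is homogeneous of degree 14 modulo 26. -/
def wt : Nat → Nat
  | 0 => 2
  | 1 => 15
  | 2 => 15
  | 3 => 14
  | 4 => 1
  | _ => 1

def monClass (r : Nat) : Nat :=
  (wt 0 * digit r 0 + wt 1 * digit r 1 + wt 2 * digit r 2 + wt 3 * digit r 3 + wt 4 * digit r 4
    + wt 5 * digit r 5) % 26

def slotClass (q J : Nat) : Nat :=
  Nat.rec 0 (fun s ih => ih + wt (5 - slot J s)) q

def classList (k : Nat) : List Nat := (monomials 6 3).filter fun e => Nat.beq (monClass e) k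

/-- Walk through `l` with the table of the positions of its entries in their classes and the table of
the class sizes, each entry taking eight bits. -/
noncomputable def tabulate (l : List Nat) (k : Nat → Nat → Nat) : Nat :=
  List.rec (motive := fun _ => Nat → Nat → Nat) k
    (fun e _ ih T S => (fun c => (fun T => Nat.rec (ih 0 0) (fun T _ => (fun S => Nat.rec (ih 0 0)
          (fun S _ => ih (Nat.succ T) (Nat.succ S)) S) (Nat.add S (Nat.shiftLeft 1 c))) T)
        (Nat.add T (Nat.shiftLeft (Nat.add (Nat.mod (Nat.shiftRight S c) 256) 1) (Nat.mul 8 e))))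
      (Nat.mul 8 (monClass e))) l 0 0

noncomputable def indexTable : Nat := tabulate (monomials 6 3) fun T _ => T
noncomputable def sizeTable : Nat := tabulate (monomials 6 3) fun _ S => S
noncomputable def lookup (e : Nat) : Nat := Nat.mod (Nat.shiftRight indexTable (Nat.mul 8 e)) 256

/-- Positions in the table start at 1, so that 0 marks a monomial that is not cubic; its coefficient
is zero and it gets the empty mask. -/
noncomputable def bit (e : Nat) : Nat :=
  Nat.rec 0 (fun i _ => Nat.shiftLeft 1 i) (lookup e)

noncomputable def dbit (r i : Nat) : Nat :=
  Nat.rec 0 (fun _ _ => bit (Nat.sub r (Nat.pow 5 i))) (digit r i)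

open Ternary

/-- Add `c` times the unknown with bit `m` to a row. -/
noncomputable def addBit (c : Int) (m p n : Nat) (k : Nat → Nat → Bool) : Bool :=
  Nat.rec (k p n) (fun x _ => Nat.rec
    (force (Nat.xor (Nat.xor p m) (Nat.land n m)) fun p' =>
      force (Nat.xor n (Nat.land (Nat.lor p n) m)) fun n' => k p' n')
    (fun _ _ => force (Nat.xor (Nat.xor n m) (Nat.land p m)) fun n' =>
      force (Nat.xor p (Nat.land (Nat.lor p n) m)) fun p' => k p' n') x) (Int.toNat (Int.emod c 3))

/-- The part of the equation at the monomial `r` that comes from the transport term. -/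
noncomputable def diagBits (r : Nat) (k : Nat → Nat → Bool) : Bool :=
  List.rec (motive := fun _ => Nat → Nat → Bool)
    (List.rec (motive := fun _ => Nat → Nat → Bool) k
      (fun x _ ih p n => addBit (x.2.2 * ((digit r x.1 + 1 : Nat) : Int))
        (Nat.rec 0 (fun _ _ => bit (Nat.add (Nat.sub r (Nat.pow 5 x.2.1)) (Nat.pow 5 x.1)))
          (digit r x.2.1)) p n ih)
      linTerms)
    (fun x _ ih p n => addBit (x.2.2.2 * ((digit r x.1 + 1 : Nat) : Int))
      (Nat.rec 0 (fun _ _ => Nat.rec 0 (fun _ _ => bit (Nat.add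
        (Nat.sub (Nat.sub r (Nat.pow 5 x.2.1)) (Nat.pow 5 x.2.2.1)) (Nat.pow 5 x.1)))
          (digit r x.2.2.1)) (digit r x.2.1)) p n ih)
    quadTerms 0 0

/-- For each monomial `r` of a class the transport part `(p, n)` of its equation and the bits of the
monomials that the slot part of the equation involves. -/
inductive Templates
  | nil
  | cons (r p n d0 d1 d2 d3 d4 d5 d6 : Nat) (rest : Templates)

inductive TemplateTable
  | nil
  | cons (l : Templates) (rest : TemplateTable)

noncomputable def mkTemplates (l : List Nat) (k : Templates → Bool) : Bool :=
  List.rec (motive := fun _ => Templates → Bool) k (fun r _ ih acc =>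
    force r fun r => diagBits r fun p n =>
    force (dbit r 0) fun d0 => force (dbit r 1) fun d1 => force (dbit r 2) fun d2 =>
    force (dbit r 3) fun d3 => force (dbit r 4) fun d4 => force (dbit r 5) fun d5 =>
    force (bit r) fun d6 => ih (.cons r p n d0 d1 d2 d3 d4 d5 d6 acc)) l .nil

noncomputable def mkTable (c : Nat) (k : TemplateTable → Bool) : Bool :=
  Nat.rec (motive := fun _ => TemplateTable → Bool) k (fun c ih acc =>
    mkTemplates ((monomials 6 4).filter fun r => Nat.beq (monClass r) c) fun l =>
      ih (.cons l acc)) c .nil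

noncomputable def getTemplates (t : TemplateTable) (c : Nat) : Templates :=
  TemplateTable.rec (motive := fun _ => Nat → Templates) (fun _ => .nil)
    (fun l _ ih c => Nat.rec l (fun c _ => ih c) c) t c

noncomputable def pick (d0 d1 d2 d3 d4 d5 d6 : Nat) (i : Nat) : Nat :=
  Nat.rec d0 (fun k _ => Nat.rec d1 (fun k _ => Nat.rec d2 (fun k _ => Nat.rec d3
    (fun k _ => Nat.rec d4 (fun k _ => Nat.rec d5 (fun _ _ => d6) k) k) k) k) k) i

/-- The slot terms of the equations of a component. -/
inductive Acts
  | nil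
  | cons (i : Nat) (c : Int) (o : Nat) (rest : Acts)

/-- The slot terms as triples of a coordinate, a coefficient and the code of a component. -/
def slotList (J : Nat) : Nat → List (Nat × Int × Nat)
  | 0 => []
  | s + 1 => (slotTerms (slot J s)).map (fun x =>
      (x.2.1, x.2.2, J - slot J s * 6 ^ s + x.1 * 6 ^ s)) ++ slotList J s

noncomputable def mkActs (l : List (Nat × Int × Nat)) (off : Nat → Nat) (k : Acts → Bool) : Bool :=
  List.rec (motive := fun _ => (Acts → Bool) → Bool) (fun k => k .nil)
    (fun x _ ih k => force (off x.2.2) fun o => force x.1 fun i =>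
      ih fun a => k (.cons i x.2.1 o a)) l k

noncomputable def actRow (a : Acts) (d0 d1 d2 d3 d4 d5 d6 p n : Nat) (k : Nat → Nat → Bool) :
    Bool :=
  Acts.rec (motive := fun _ => Nat → Nat → Bool) k (fun i c o _ ih p n =>
    (fun m => ifZero m (ih p n) (addBit c (Nat.shiftLeft m o) p n ih))
      (pick d0 d1 d2 d3 d4 d5 d6 i)) a p n

/-- The equations of one component. -/
noncomputable def genSlot (o : Nat) (a : Acts) (tl : Templates) (rows : Rows) (k : Rows → Bool) :
    Bool :=
  Templates.rec (motive := fun _ => Rows → Bool) k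
    (fun r p n d0 d1 d2 d3 d4 d5 d6 _ ih rows =>
      -- The reserved low 64 bits are filled with a multiplicative hash of the component and the
      -- monomial. The two constants select complementary bit positions, so the masks stay disjoint
      -- there.
      force (Nat.lor (Nat.shiftLeft p o) (Nat.land 0x5555555555555555
        (Nat.mul (Nat.add o (Nat.mul r 4099)) 0x9E3779B97F4A7C15))) fun p =>
      force (Nat.lor (Nat.shiftLeft n o) (Nat.land 0xAAAAAAAAAAAAAAAA
        (Nat.mul (Nat.add o (Nat.mul r 4099)) 0x9E3779B97F4A7C15))) fun n =>
      ifZero (Nat.land p n) (actRow a d0 d1 d2 d3 d4 d5 d6 p n fun p n =>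
        ifZero (Nat.shiftRight (Nat.lor p n) 64) (ih rows) (ih (.cons p n rows))) (ih rows)) tl rows

/-- The equations of class `c` of all components. -/
noncomputable def generate (q c : Nat) (off : Nat → Nat) (t : TemplateTable) (rows : Rows)
    (k : Rows → Bool) : Bool :=
  Nat.rec (motive := fun _ => Rows → Bool) k (fun J ih rows =>
    mkActs (slotList J q) off fun a => force (off J) fun o =>
      -- The field raises the class by 14, so the equation at `r` involves unknowns of class `c`
      -- when `r` has class `c + 14` minus that of the slots. The rest of 92 is `78 = 3 * 26`, which
      -- keeps the subtraction from being truncated.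
      genSlot o a (getTemplates t (Nat.mod (Nat.sub (Nat.add c 92) (slotClass q J)) 26)) rows ih) (Nat.pow 6 q) rows

noncomputable def classSize (q c J : Nat) : Nat :=
  Nat.mod (Nat.shiftRight sizeTable
    (Nat.mul 8 (Nat.mod (Nat.sub (Nat.add c 78) (slotClass q J)) 26))) 256

/-- The positions of the first unknown of each component, each taking sixteen bits. -/
noncomputable def mkOffsets (q c : Nat) (n : Nat) (k : Nat → Bool) : Bool :=
  Nat.rec (motive := fun _ => Nat → Nat → Nat → Bool) (fun _ _ O => k O)
    (fun _ ih J o O => force (Nat.lor O (Nat.shiftLeft o (Nat.mul 16 J))) fun O =>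
      force (Nat.add o (classSize q c J)) fun o => force (Nat.add J 1) fun J => ih J o O) n 0 64 0

noncomputable def offset (O J : Nat) : Nat := Nat.mod (Nat.shiftRight O (Nat.mul 16 J)) 65536

noncomputable def checkOffsets (q c O n : Nat) : Bool :=
  Nat.rec (motive := fun _ => Bool) (Nat.beq (offset O 0) 64)
    (fun J ih => Bool.rec false ih
      (Nat.beq (offset O (Nat.succ J)) (Nat.add (offset O J) (classSize q c J)))) n

/-- The coefficients that are normalised to zero, as slot code and monomial. -/
def normals : Nat → List (Nat × Nat)
  | 0 => [(0, 0)]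
  | s + 1 => (normals s).flatMap fun x =>
      [(6 * x.1 + 4, x.2 + 5 ^ 1), (6 * x.1 + 3, x.2 + 5 ^ 5), (6 * x.1 + 2, x.2 + 5 ^ 3)]

noncomputable def normalRows (q c : Nat) (off : Nat → Nat) (rows : Rows) (k : Rows → Bool) : Bool :=
  List.rec (motive := fun _ => Rows → Bool) k (fun x _ ih rows =>
    Bool.rec (ih rows) (force (Nat.shiftLeft (bit x.2) (off x.1)) fun p => ih (.cons p 0 rows))
      (Nat.beq (Nat.mod (Nat.add (slotClass q x.1) (monClass x.2)) 26) c)) (normals q) rows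

/-- Whether elimination shows that all unknowns of class `c` vanish. -/
noncomputable def solve (q c : Nat) (cs : List Nat) : Bool :=
  mkTable 26 fun t => mkOffsets q c (Nat.add (Nat.pow 6 q) 1) fun O =>
    Bool.rec false (generate q c (offset O) t .nil fun rows =>
      normalRows q c (offset O) rows fun rows =>
        eliminate cs rows (Nat.sub (Nat.pow 2 (offset O (Nat.pow 6 q))) 1))
      (checkOffsets q c O (Nat.pow 6 q))

/-! ### Soundness of the elimination over the field with three elements -/

namespace Ternary

theorem force_eq (n : ℕ) (k : ℕ → Bool) : force n k = k n := by cases n <;> rfl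

theorem ifZero_eq (n : ℕ) (a b : Bool) : ifZero n a b = if n = 0 then a else b := by
  cases n <;> rfl

def sgn (p n : Bool) : ZMod 3 := (if p then 1 else 0) - (if n then 1 else 0)

def value (N : ℕ) (φ : ℕ → ZMod 3) (p n : ℕ) : ZMod 3 :=
  ∑ i ∈ Finset.range N, sgn (p.testBit i) (n.testBit i) * φ i

/-- The invariant of the elimination: `φ` is a fixed solution and every row is an equation that `φ`
satisfies. Nothing is claimed about completeness. -/
structure Valid (N : ℕ) (φ : ℕ → ZMod 3) (p n : ℕ) : Prop where
  disj : p &&& n = 0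
  value_eq : value N φ p n = 0

theorem testBit_disj {p n : ℕ} (h : p &&& n = 0) (i : ℕ) : (p.testBit i && n.testBit i) = false := by
  rw [← Nat.testBit_land, h, Nat.zero_testBit]

/-- `t` is the support of the sum, and a coefficient of the sum is `1` where exactly one summand is
`1` or both are `-1`. As in all soundness statements below, a program in continuation passing style
is described by the values that it hands to `k`. -/
theorem add_sound (N : ℕ) (φ : ℕ → ZMod 3) {p n p' n' : ℕ} (h : p &&& n = 0) (h' : p' &&& n' = 0)
    (k : ℕ → ℕ → Bool) :
    ∃ q r, q &&& r = 0 ∧ value N φ q r = value N φ p n + value N φ p' n' ∧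
      add p n p' n' k = k q r := by
  set t := (p ||| p') ^^^ (n ||| n') with ht
  set q := t &&& ((p ^^^ p') ||| (n &&& n')) with hq
  refine ⟨q, t ^^^ q, ?_, ?_, ?_⟩
  · apply Nat.eq_of_testBit_eq
    intro i
    simp only [hq, Nat.testBit_land, Nat.testBit_xor, Nat.zero_testBit]
    generalize t.testBit i = a
    generalize ((p ^^^ p') ||| (n &&& n')).testBit i = b
    revert a b; decide
  · rw [value, value, value, ← Finset.sum_add_distrib]
    refine Finset.sum_congr rfl fun i _ => ?_
    rw [← add_mul]
    congr 1
    have h1 := testBit_disj h i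
    have h2 := testBit_disj h' i
    simp only [hq, ht, Nat.testBit_land, Nat.testBit_xor, Nat.testBit_lor]
    generalize p.testBit i = a at *
    generalize n.testBit i = b at *
    generalize p'.testBit i = c at *
    generalize n'.testBit i = d at *
    revert a b c d; decide
  · simp only [add, force_eq]
    rfl

theorem value_swap (N : ℕ) (φ : ℕ → ZMod 3) (p n : ℕ) : value N φ n p = -value N φ p n := by
  rw [value, value, ← Finset.sum_neg_distrib]
  refine Finset.sum_congr rfl fun i _ => ?_
  simp only [sgn]; ring

theorem Valid.swap {N : ℕ} {φ : ℕ → ZMod 3} {p n : ℕ} (h : Valid N φ p n) : Valid N φ n p :=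
  ⟨by rw [Nat.land_comm]; exact h.disj, by rw [value_swap, h.value_eq, neg_zero]⟩

theorem Valid.add {N : ℕ} {φ : ℕ → ZMod 3} {p n p' n' : ℕ} (h : Valid N φ p n)
    (h' : Valid N φ p' n') (k : ℕ → ℕ → Bool) :
    ∃ q r, Valid N φ q r ∧ Ternary.add p n p' n' k = k q r := by
  obtain ⟨q, r, h1, h2, h3⟩ := add_sound N φ h.disj h'.disj k
  exact ⟨q, r, ⟨h1, by rw [h2, h.value_eq, h'.value_eq, add_zero]⟩, h3⟩

def Rows.All (P : ℕ → ℕ → Prop) : Rows → Prop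
  | .nil => True
  | .cons p n r => P p n ∧ r.All P

def Tree.All (P : ℕ → ℕ → Prop) : Tree → Prop
  | .leaf => True
  | .tip p n => P p n
  | .node _ a b => a.All P ∧ b.All P

theorem find_sound {P : ℕ → ℕ → Prop} {t : Tree} (ht : t.All P) (j : ℕ) (k : ℕ → ℕ → Bool)
    (d : Bool) : find t j k d = d ∨ ∃ p n, P p n ∧ find t j k d = k p n := by
  induction t with
  | leaf => exact Or.inl rfl
  | tip p n => exact Or.inr ⟨p, n, ht, rfl⟩
  | node m a b iha ihb =>
    have e : find (.node m a b) j k d = Bool.rec (find b j k d) (find a j k d) (Nat.ble j m) := rfl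
    rw [e]
    cases Nat.ble j m
    · exact ihb ht.2
    · exact iha ht.1

theorem insert_sound {P : ℕ → ℕ → Prop} {t : Tree} (ht : t.All P) (j : ℕ) {p n : ℕ} (h : P p n)
    (k : Tree → Bool) : ∃ t' : Tree, t'.All P ∧ insert t j p n k = k t' := by
  induction t generalizing k with
  | leaf => exact ⟨.tip p n, h, rfl⟩
  | tip p' n' => exact ⟨.tip p n, h, rfl⟩
  | node m a b iha ihb =>
    have e : insert (.node m a b) j p n k = Bool.rec (insert b j p n fun b => k (.node m a b))
      (insert a j p n fun a => k (.node m a b)) (Nat.ble j m) := rfl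
    rw [e]
    cases Nat.ble j m
    · obtain ⟨t', h1, h2⟩ := ihb ht.2 fun b => k (.node m a b)
      exact ⟨.node m a t', ⟨ht.1, h1⟩, h2⟩
    · obtain ⟨t', h1, h2⟩ := iha ht.1 fun a => k (.node m a b)
      exact ⟨.node m t' b, ⟨h1, ht.2⟩, h2⟩

theorem blank_all (P : ℕ → ℕ → Prop) (d lo : ℕ) : (blank d lo).All P := by
  induction d generalizing lo with
  | zero => trivial
  | succ d ih => exact ⟨ih _, ih _⟩

/-- The row that is looked up need not contain the intended pivot, and the fuel may run out: adding
or subtracting any valid row preserves validity. -/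
theorem subst_sound {N : ℕ} {φ : ℕ → ZMod 3} {t : Tree} (ht : t.All (Valid N φ)) (fuel v : ℕ)
    {p n : ℕ} (h : Valid N φ p n) (k : ℕ → ℕ → Bool) :
    ∃ p' n', Valid N φ p' n' ∧ subst fuel t v p n k = k p' n' := by
  induction fuel generalizing p n with
  | zero => exact ⟨p, n, h, rfl⟩
  | succ fuel ih =>
    have e : subst (fuel + 1) t v p n k = (fun s => ifZero s (k p n)
      (force (low s) fun b => find t (Nat.mod b 2131) (fun p' n' =>
        ifZero (Nat.land (Nat.shiftRight p 64) b) (add p n p' n' fun p n => subst fuel t v p n k)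
          (add p n n' p' fun p n => subst fuel t v p n k)) (k p n)))
      (Nat.shiftRight (Nat.land (Nat.lor p n) v) 64) := rfl
    rw [e]
    simp only [ifZero_eq, force_eq]
    by_cases h0 : Nat.shiftRight (Nat.land (Nat.lor p n) v) 64 = 0
    · rw [if_pos h0]
      exact ⟨p, n, h, rfl⟩
    · rw [if_neg h0]
      rcases find_sound ht (Nat.mod (low (Nat.shiftRight (Nat.land (Nat.lor p n) v) 64)) 2131)
        (fun p' n' => if Nat.land (Nat.shiftRight p 64)
            (low (Nat.shiftRight (Nat.land (Nat.lor p n) v) 64)) = 0 then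
          (add p n p' n' fun p n => subst fuel t v p n k)
          else (add p n n' p' fun p n => subst fuel t v p n k)) (k p n) with h1 | ⟨p', n', h1, h2⟩
      · exact ⟨p, n, h, h1⟩
      · rw [h2]
        split_ifs
        · obtain ⟨q, r, h3, h4⟩ := h.add h1 fun p n => subst fuel t v p n k
          rw [h4]; exact ih h3
        · obtain ⟨q, r, h3, h4⟩ := h.add h1.swap fun p n => subst fuel t v p n k
          rw [h4]; exact ih h3

/-- Every index outside the mask `u` is known to have value zero. -/
def Mask (φ : ℕ → ZMod 3) (u : ℕ) : Prop := ∀ i, u.testBit i = false → φ i = 0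

theorem Valid.mask {N : ℕ} {φ : ℕ → ZMod 3} {p n u : ℕ} (h : Valid N φ p n) (hu : Mask φ u) :
    Valid N φ (p &&& u) (n &&& u) := by
  constructor
  · apply Nat.eq_of_testBit_eq
    intro i
    have := testBit_disj h.disj i
    simp only [Nat.testBit_land, Nat.zero_testBit]
    revert this
    generalize p.testBit i = a
    generalize n.testBit i = b
    generalize u.testBit i = c
    revert a b c; decide
  · rw [← h.value_eq]
    refine Finset.sum_congr rfl fun i _ => ?_
    by_cases hi : u.testBit i
    · simp [hi]
    · rw [hu i (by simpa using hi), mul_zero, mul_zero]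

theorem testBit_eq_of_land_pred {x : ℕ} (h : x &&& (x - 1) = 0) {i j : ℕ} (hi : x.testBit i = true)
    (hj : x.testBit j = true) : i = j := by
  have hx : x ≠ 0 := by rintro rfl; simp at hi
  obtain ⟨k, rfl⟩ : ∃ k, x = 2 ^ k := by
    exact (Nat.and_sub_one_eq_zero_iff_isPowerOfTwo hx).1 h
  rw [Nat.testBit_two_pow] at hi hj
  simp at hi hj
  omega

/-- A valid row with at most one index above the reserved ones kills that index. -/
theorem Valid.single {N : ℕ} {φ : ℕ → ZMod 3} (hlow : ∀ i < 64, φ i = 0) (hN : ∀ i ≥ N, φ i = 0)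
    {p n x : ℕ} (h : Valid N φ p n) (hx : x = (p ||| n) >>> 64) (h1 : x &&& (x - 1) = 0) {i : ℕ}
    (hi : x.testBit i = true) : φ (i + 64) = 0 := by
  by_cases hiN : N ≤ i + 64
  · exact hN _ hiN
  have hv := h.value_eq
  rw [value, Finset.sum_eq_single (i + 64)] at hv
  · rw [hx, Nat.testBit_shiftRight, Nat.testBit_lor, add_comm] at hi
    have hd := testBit_disj h.disj (i + 64)
    revert hv hi hd
    generalize φ (i + 64) = y
    generalize p.testBit (i + 64) = a
    generalize n.testBit (i + 64) = b
    revert a b y; decide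
  · intro j _ hj
    by_cases hj64 : j < 64
    · rw [hlow j hj64, mul_zero]
    · have : x.testBit (j - 64) = false := by
        by_contra hc
        have := testBit_eq_of_land_pred h1 hi (by simpa using hc)
        omega
      rw [hx, Nat.testBit_shiftRight, Nat.testBit_lor, show 64 + (j - 64) = j by omega,
        Bool.or_eq_false_iff] at this
      simp [this.1, this.2, sgn]
  · intro hc
    exact absurd (Finset.mem_range.2 (by omega)) hc

/-- The term `j` only perturbs the reserved low bits, where `φ` vanishes anyway. If a bit of `x` was
not set in `u`, the exclusive or sets it, which merely weakens the mask. -/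
theorem Mask.erase {φ : ℕ → ZMod 3} (hlow : ∀ i < 64, φ i = 0) {u x j : ℕ} (hu : Mask φ u)
    (hj : j < 2 ^ 64) (hx : ∀ i, x.testBit i = true → φ (i + 64) = 0) :
    Mask φ (u ^^^ ((x <<< 64) ^^^ j)) := by
  intro i hi
  by_cases hi64 : i < 64
  · exact hlow i hi64
  by_cases hxi : x.testBit (i - 64) = true
  · have := hx _ hxi
    rwa [show i - 64 + 64 = i by omega] at this
  · apply hu
    have hji : j.testBit i = false :=
      Nat.testBit_lt_two_pow (lt_of_lt_of_le hj (Nat.pow_le_pow_right (by norm_num) (by omega)))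
    simp only [Nat.testBit_xor, Nat.testBit_shiftLeft, hji] at hi
    simpa [hxi] using hi

theorem low_eq {x : ℕ} (h : x &&& (x - 1) = 0) : low x = x := by
  apply Nat.eq_of_testBit_eq
  intro i
  have h1 := testBit_disj h i
  have e : low x = x &&& (x ^^^ (x - 1)) := rfl
  rw [e, Nat.testBit_land, Nat.testBit_xor]
  revert h1
  generalize x.testBit i = a
  generalize (x - 1).testBit i = b
  revert a b; decide

structure State.Good (N : ℕ) (φ : ℕ → ZMod 3) (st : State) : Prop where
  mask : Mask φ st.u
  tree : st.t.All (Valid N φ)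
  rows : st.s.All (Valid N φ)

/-- A row is either kept for a later pass, or discarded as trivial, or kills a single unknown, or
becomes a pivot row. The exit `done` is taken when no free unknown is left. Tree rows are stored
with pivot coefficient `1`, possibly after a sign change, which `Valid.swap` allows. -/
theorem step_sound {N : ℕ} {φ : ℕ → ZMod 3} (hlow : ∀ i < 64, φ i = 0) (hN : ∀ i ≥ N, φ i = 0)
    (c : ℕ) {st : State} (hst : st.Good N φ) {p n : ℕ} (h : Valid N φ p n) (keep : ℕ → ℕ → Bool)
    (done k : State → Bool) :
    (∃ p' n', Valid N φ p' n' ∧ step c st p n keep done k = keep p' n') ∨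
    ∃ st' : State, st'.Good N φ ∧
      (step c st p n keep done k = done st' ∨ step c st p n keep done k = k st') := by
  obtain ⟨u, v, f, t, s⟩ := st
  obtain ⟨hu, ht, hs⟩ := hst
  simp only at hu ht hs
  have e : step c ⟨u, v, f, t, s⟩ p n keep done k = Bool.rec (keep p n)
      (subst 5000 t v p n fun p n => force (Nat.land p u) fun p => force (Nat.land n u) fun n =>
        (fun x => ifZero x (k (.mk u v f t s))
          (Bool.rec (keep p n)
            (force (low x) fun b => force (Nat.mod b 2131) fun j =>
              force (Nat.xor (Nat.shiftLeft b 64) j) fun b' =>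
              force (Nat.xor f b') fun f =>
              ifZero (Nat.land x (Nat.sub x 1))
                (force (Nat.xor u b') fun u =>
                  ifZero (Nat.shiftRight f 64) (done (.mk u v f t s)) (k (.mk u v f t s)))
                (force (Nat.lor v b') fun v => ifZero (Nat.land (Nat.shiftRight p 64) b)
                  (insert t j n p fun t => ifZero (Nat.shiftRight f 64)
                    (done (.mk u v f t (.cons p n s))) (k (.mk u v f t (.cons p n s))))
                  (insert t j p n fun t => ifZero (Nat.shiftRight f 64)
                    (done (.mk u v f t (.cons p n s))) (k (.mk u v f t (.cons p n s))))))
            (atMost c x))) (Nat.shiftRight (Nat.lor p n) 64))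
      (atMost c (Nat.shiftRight (Nat.land (Nat.lor p n) f) 64)) := rfl
  rw [e]
  cases atMost c (Nat.shiftRight (Nat.land (Nat.lor p n) f) 64)
  · exact Or.inl ⟨p, n, h, rfl⟩
  simp only [force_eq, ifZero_eq]
  obtain ⟨p, n, h, e⟩ := subst_sound ht 5000 v h _
  rw [e]
  clear e
  have h := h.mask hu
  change Valid N φ (Nat.land p u) (Nat.land n u) at h
  generalize Nat.land p u = p at h ⊢
  generalize Nat.land n u = n at h ⊢
  obtain ⟨x, hx⟩ : ∃ x, x = Nat.shiftRight (Nat.lor p n) 64 := ⟨_, rfl⟩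
  rw [← hx]
  by_cases h0 : x = 0
  · rw [if_pos h0]
    exact Or.inr ⟨_, ⟨hu, ht, hs⟩, Or.inr rfl⟩
  rw [if_neg h0]
  cases atMost c x
  · exact Or.inl ⟨p, n, h, rfl⟩
  right
  simp only
  by_cases h1 : Nat.land x (Nat.sub x 1) = 0
  · rw [if_pos h1]
    have h1' : x &&& (x - 1) = 0 := h1
    have hu' := hu.erase hlow (x := x) (j := Nat.mod x 2131)
      (lt_trans (Nat.mod_lt _ (by norm_num)) (by norm_num)) fun i hi => h.single hlow hN hx h1' hi
    rw [low_eq h1']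
    split_ifs
    · exact ⟨_, ⟨hu', ht, hs⟩, Or.inl rfl⟩
    · exact ⟨_, ⟨hu', ht, hs⟩, Or.inr rfl⟩
  · rw [if_neg h1]
    have hs' : (Rows.cons p n s).All (Valid N φ) := ⟨h, hs⟩
    split_ifs with h2 h3 h3
    · obtain ⟨t', ht', e⟩ := insert_sound ht (Nat.mod (low x) 2131) h.swap fun t' =>
        done (.mk u (Nat.lor v (Nat.xor (Nat.shiftLeft (low x) 64) (Nat.mod (low x) 2131)))
          (Nat.xor f (Nat.xor (Nat.shiftLeft (low x) 64) (Nat.mod (low x) 2131))) t' (.cons p n s))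
      refine ⟨_, ?_, Or.inl e⟩
      exact ⟨hu, ht', hs'⟩
    · obtain ⟨t', ht', e⟩ := insert_sound ht (Nat.mod (low x) 2131) h.swap fun t' =>
        k (.mk u (Nat.lor v (Nat.xor (Nat.shiftLeft (low x) 64) (Nat.mod (low x) 2131)))
          (Nat.xor f (Nat.xor (Nat.shiftLeft (low x) 64) (Nat.mod (low x) 2131))) t' (.cons p n s))
      refine ⟨_, ?_, Or.inr e⟩
      exact ⟨hu, ht', hs'⟩
    · obtain ⟨t', ht', e⟩ := insert_sound ht (Nat.mod (low x) 2131) h fun t' =>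
        done (.mk u (Nat.lor v (Nat.xor (Nat.shiftLeft (low x) 64) (Nat.mod (low x) 2131)))
          (Nat.xor f (Nat.xor (Nat.shiftLeft (low x) 64) (Nat.mod (low x) 2131))) t' (.cons p n s))
      refine ⟨_, ?_, Or.inl e⟩
      exact ⟨hu, ht', hs'⟩
    · obtain ⟨t', ht', e⟩ := insert_sound ht (Nat.mod (low x) 2131) h fun t' =>
        k (.mk u (Nat.lor v (Nat.xor (Nat.shiftLeft (low x) 64) (Nat.mod (low x) 2131)))
          (Nat.xor f (Nat.xor (Nat.shiftLeft (low x) 64) (Nat.mod (low x) 2131))) t' (.cons p n s))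
      refine ⟨_, ?_, Or.inr e⟩
      exact ⟨hu, ht', hs'⟩

theorem pass_sound {N : ℕ} {φ : ℕ → ZMod 3} (hlow : ∀ i < 64, φ i = 0) (hN : ∀ i ≥ N, φ i = 0)
    (c : ℕ) {rows : Rows} (hr : rows.All (Valid N φ)) {st : State} (hst : st.Good N φ)
    {kept : Rows} (hk : kept.All (Valid N φ)) (done : State → Bool) (k : State → Rows → Bool) :
    ∃ st' : State, st'.Good N φ ∧ (pass c rows st kept done k = done st' ∨
      ∃ rows' : Rows, rows'.All (Valid N φ) ∧ pass c rows st kept done k = k st' rows') := by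
  induction rows generalizing st kept with
  | nil => exact ⟨st, hst, Or.inr ⟨kept, hk, rfl⟩⟩
  | cons p n r ih =>
    have e : pass c (.cons p n r) st kept done k = step c st p n
      (fun p n => pass c r st (.cons p n kept) done k) done (fun st => pass c r st kept done k) := rfl
    rw [e]
    rcases step_sound hlow hN c hst hr.1 (fun p n => pass c r st (.cons p n kept) done k) done
      (fun st => pass c r st kept done k) with ⟨p', n', h1, h2⟩ | ⟨st', h1, h2 | h2⟩
    · rw [h2]
      exact ih hr.2 hst ⟨h1, hk⟩
    · exact ⟨st', h1, Or.inl h2⟩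
    · rw [h2]
      exact ih hr.2 h1 hk

theorem passes_sound {N : ℕ} {φ : ℕ → ZMod 3} (hlow : ∀ i < 64, φ i = 0) (hN : ∀ i ≥ N, φ i = 0)
    (cs : List ℕ) {rows : Rows} (hr : rows.All (Valid N φ)) {st : State} (hst : st.Good N φ)
    (done : State → Bool) : ∃ st' : State, st'.Good N φ ∧ passes cs rows st done = done st' := by
  induction cs generalizing st rows with
  | nil => exact ⟨st, hst, rfl⟩
  | cons c cs ih =>
    have e : passes (c :: cs) rows st done =
      pass c rows st .nil done fun st rows => passes cs rows st done := rfl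
    rw [e]
    obtain ⟨st', h1, h2 | ⟨rows', h2, h3⟩⟩ := pass_sound hlow hN c hr hst (kept := .nil) trivial done
      fun st rows => passes cs rows st done
    · exact ⟨st', h1, h2⟩
    · rw [h3]
      exact ih h2 h1

/-- A valid row with at most one undetermined unknown forces that unknown to vanish. The order of
the rows plays no role for soundness. -/
theorem backSubst_sound {N : ℕ} {φ : ℕ → ZMod 3} (hlow : ∀ i < 64, φ i = 0)
    (hN : ∀ i ≥ N, φ i = 0) {s : Rows} (hs : s.All (Valid N φ)) {u : ℕ} (hu : Mask φ u)
    (h : backSubst s u = true) (i : ℕ) : φ i = 0 := by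
  induction s generalizing u with
  | nil =>
    have h' : u >>> 64 = 0 := Nat.eq_of_beq_eq_true h
    by_cases hi : i < 64
    · exact hlow i hi
    · apply hu
      have : (u >>> 64).testBit (i - 64) = false := by rw [h', Nat.zero_testBit]
      rwa [Nat.testBit_shiftRight, show 64 + (i - 64) = i by omega] at this
  | cons p n r ih =>
    obtain ⟨x, hx⟩ : ∃ x, x = Nat.shiftRight (Nat.land (Nat.lor p n) u) 64 := ⟨_, rfl⟩
    have e : backSubst (.cons p n r) u = ifZero (Nat.land x (Nat.sub x 1))
      (force (Nat.xor u (Nat.xor (Nat.shiftLeft x 64) (Nat.mod x 2131))) (backSubst r))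
      (backSubst r u) := by rw [hx]; rfl
    rw [e, ifZero_eq, force_eq] at h
    split_ifs at h with h1
    · refine ih hs.2 (hu.erase hlow (lt_trans (Nat.mod_lt _ (by norm_num)) (by norm_num))
        fun i hi => (hs.1.mask hu).single hlow hN ?_ h1 hi) h
      rw [hx, ← Nat.and_or_distrib_right]
      rfl
    · exact ih hs.2 hu h

theorem eliminate_sound {N : ℕ} {φ : ℕ → ZMod 3} (hlow : ∀ i < 64, φ i = 0)
    (hN : ∀ i ≥ N, φ i = 0) (cs : List ℕ) {rows : Rows} (hr : rows.All (Valid N φ)) {u : ℕ}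
    (hu : Mask φ u) (h : eliminate cs rows u = true) (i : ℕ) : φ i = 0 := by
  rw [eliminate, force_eq] at h
  obtain ⟨st', h1, h2⟩ := passes_sound hlow hN cs hr (st := ⟨u, 0, u, blank 12 0, .nil⟩)
    ⟨hu, (blank_all _ _ _ : (blank 12 0).All (Valid N φ)), trivial⟩ fun st => State.rec (fun u _ _ _ s => backSubst s u) st
  rw [h2] at h
  exact backSubst_sound hlow hN h1.rows h1.mask h i

end Ternary

/-! ### The linear system for `a = 1`, with values in an abelian group -/

section System
variable {A : Type*} [AddCommGroup A]

/-- This is the coefficient at the monomial `r` of the quadratic part of `∑ Xᵏ ∂ₖ` applied to the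
polynomial with coefficients `ρ`. The term `xᵢ xⱼ ∂ₖ` takes it from `r xₖ / (xᵢ xⱼ)`;
differentiation brings down the exponent of `xₖ` there, which is that of `r` plus one because `k`
differs from `i` and `j`. -/
def quadSum (ρ : ℕ → A) (r : ℕ) : A :=
  (quadTerms.map fun x => if digit r x.2.1 = 0 then 0 else if digit r x.2.2.1 = 0 then 0 else
    (x.2.2.2 * ((digit r x.1 + 1 : ℕ) : ℤ)) • ρ (r - 5 ^ x.2.1 - 5 ^ x.2.2.1 + 5 ^ x.1)).sum

def linSum (ρ : ℕ → A) (r : ℕ) : A :=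
  (linTerms.map fun x => if digit r x.2.1 = 0 then 0 else
    (x.2.2 * ((digit r x.1 + 1 : ℕ) : ℤ)) • ρ (r - 5 ^ x.2.1 + 5 ^ x.1)).sum

def shifted (ρ : ℕ → A) (r i : ℕ) : A :=
  if i = 6 then ρ r else if digit r i = 0 then 0 else ρ (r - 5 ^ i)

def slotSum (τ : ℕ → ℕ → A) (q J r : ℕ) : A :=
  ((slotList J q).map fun x => x.2.1 • shifted (τ x.2.2) r x.1).sum

/-- The equations for the coefficients of an invariant tensor field of type `(0, q)` with cubic
components, normalised to have no component along the known solutions. -/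
structure System (q : ℕ) (τ : ℕ → ℕ → A) : Prop where
  eqn : ∀ J < 6 ^ q, ∀ r ∈ monomials 6 4,
    quadSum (τ J) r + linSum (τ J) r + slotSum τ q J r = 0
  supp : ∀ J e, ¬(J < 6 ^ q ∧ e ∈ monomials 6 3) → τ J e = 0
  normal : ∀ x ∈ normals q, τ x.1 x.2 = 0

end System

/-! ### Monomial codes and homogeneity of the equations -/

def isMonomial : ℕ → ℕ → ℕ → Bool
  | 0, _, e => e == 0
  | v + 1, d, e => decide (e % 5 ≤ d) && isMonomial v (d - e % 5) (e / 5)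

theorem mem_monomials {v d e : ℕ} (hd : d ≤ 4) : e ∈ monomials v d ↔ isMonomial v d e = true := by
  induction v generalizing d e with
  | zero => simp [monomials, isMonomial]
  | succ v ih =>
    simp only [monomials, isMonomial, List.mem_flatMap, List.mem_range, List.mem_map,
      Bool.and_eq_true, decide_eq_true_eq]
    constructor
    · rintro ⟨a, ha, r, hr, rfl⟩
      have h1 : (a + 5 * r) % 5 = a := by omega
      have h2 : (a + 5 * r) / 5 = r := by omega
      rw [h1, h2]
      exact ⟨by omega, (ih (by omega)).1 hr⟩
    · rintro ⟨h1, h2⟩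
      exact ⟨e % 5, by omega, e / 5, (ih (by omega)).2 h2, by omega⟩

theorem monClass_lt (e : ℕ) : monClass e < 26 := Nat.mod_lt _ (by norm_num)

theorem slotClass_le (q J : ℕ) : slotClass q J ≤ 15 * q := by
  induction q with
  | zero => exact le_rfl
  | succ q ih =>
    have e : slotClass (q + 1) J = slotClass q J + wt (5 - slot J q) := rfl
    have : ∀ i, wt i ≤ 15 := by intro i; unfold wt; split <;> omega
    have := this (5 - slot J q)
    omega

/-- The weights `wt` combine two gradings. Modulo 13 they are the scaling weights, 2 for `γᵢ` and 1
for `Mᵢ`, for which the field has degree 1; unknowns with `q ≤ 3` have weight at most 12, so the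
reduction loses nothing. Modulo 2 they record the symmetry that changes the sign of `γ₂, γ₃, M₂,
M₃`. -/
theorem quad_target : ∀ r ∈ monomials 6 4, ∀ x ∈ quadTerms, digit r x.2.1 ≠ 0 →
    digit r x.2.2.1 ≠ 0 → isMonomial 6 4 (r - 5 ^ x.2.1 - 5 ^ x.2.2.1 + 5 ^ x.1) = true ∧
    (monClass (r - 5 ^ x.2.1 - 5 ^ x.2.2.1 + 5 ^ x.1) + 14) % 26 = monClass r := by
  decide +kernel

theorem lin_target : ∀ r ∈ monomials 6 4, ∀ x ∈ linTerms, digit r x.2.1 ≠ 0 →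
    isMonomial 6 4 (r - 5 ^ x.2.1 + 5 ^ x.1) = true ∧
    (monClass (r - 5 ^ x.2.1 + 5 ^ x.1) + 14) % 26 = monClass r := by
  decide +kernel

theorem shift_target : ∀ r ∈ monomials 6 4, ∀ i < 6, digit r i ≠ 0 →
    isMonomial 6 4 (r - 5 ^ i) = true ∧ (monClass (r - 5 ^ i) + wt i) % 26 = monClass r := by
  decide +kernel

/-- This ties the packed table to the lists `classList`, so that later arguments can speak of list
positions. -/
theorem lookup_spec : ∀ e ∈ monomials 6 4,
    (lookup e = 0 ∧ isMonomial 6 3 e = false) ∨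
    (lookup e ≠ 0 ∧ (classList (monClass e))[lookup e - 1]? = some e) := by
  decide +kernel

theorem sizeTable_spec : ∀ k < 26,
    Nat.mod (Nat.shiftRight sizeTable (Nat.mul 8 k)) 256 = (classList k).length := by
  decide +kernel

/-! ### Soundness of the generated rows -/

namespace Ternary

theorem value_eq_zero_left (N : ℕ) (φ : ℕ → ZMod 3) : value N φ 0 0 = 0 := by
  simp [value, sgn]

theorem value_one_shiftLeft {N : ℕ} {φ : ℕ → ZMod 3} (hN : ∀ i ≥ N, φ i = 0) (i : ℕ) :
    value N φ (1 <<< i) 0 = φ i := by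
  have h : ∀ j, Nat.testBit (1 <<< i) j = decide (i = j) := by
    intro j; rw [Nat.one_shiftLeft, Nat.testBit_two_pow]
  simp only [value, sgn, h, Nat.zero_testBit]
  by_cases hi : i < N
  · rw [Finset.sum_eq_single i]
    · simp
    · intro j _ hj
      simp [Ne.symm hj]
    · intro hc; exact absurd (Finset.mem_range.2 hi) hc
  · rw [hN i (by omega)]
    refine Finset.sum_eq_zero fun j hj => ?_
    have : i ≠ j := by have := Finset.mem_range.1 hj; omega
    simp [this]

theorem value_shiftLeft {N : ℕ} {φ : ℕ → ZMod 3} (hN : ∀ i ≥ N, φ i = 0) (p n o : ℕ) :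
    value N φ (p <<< o) (n <<< o) = value N (fun i => φ (i + o)) p n := by
  rw [value, value]
  have h1 : ∑ i ∈ Finset.range N, sgn (p.testBit i) (n.testBit i) * φ (i + o) =
      ∑ i ∈ Finset.range (N - o), sgn (p.testBit i) (n.testBit i) * φ (i + o) := by
    symm
    apply Finset.sum_subset
    · intro i hi; simp only [Finset.mem_range] at *; omega
    · intro i _ hi
      rw [hN (i + o) (by simp only [Finset.mem_range] at hi; omega), mul_zero]
  rw [h1]
  by_cases ho : o ≤ N
  · have h2 : N = o + (N - o) := by omega
    conv_lhs => rw [h2]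
    rw [Finset.sum_range_add, Finset.sum_eq_zero, zero_add]
    · refine Finset.sum_congr rfl fun i _ => ?_
      simp [Nat.testBit_shiftLeft, add_comm o i]
    · intro i hi
      have : ¬ o ≤ i := by have := Finset.mem_range.1 hi; omega
      simp [Nat.testBit_shiftLeft, this, sgn]
  · rw [Finset.sum_eq_zero, show N - o = 0 by omega, Finset.sum_range_zero]
    intro i hi
    have : ¬ o ≤ i := by have := Finset.mem_range.1 hi; omega
    simp [Nat.testBit_shiftLeft, this, sgn]

theorem value_lor {N : ℕ} {φ : ℕ → ZMod 3} (hlow : ∀ i < 64, φ i = 0) (p n a b : ℕ)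
    (ha : a < 2 ^ 64) (hb : b < 2 ^ 64) : value N φ (p ||| a) (n ||| b) = value N φ p n := by
  refine Finset.sum_congr rfl fun i _ => ?_
  by_cases hi : i < 64
  · rw [hlow i hi, mul_zero, mul_zero]
  · have h : (2 : ℕ) ^ 64 ≤ 2 ^ i := Nat.pow_le_pow_right (by norm_num) (by omega)
    rw [Nat.testBit_lor, Nat.testBit_lor, Nat.testBit_lt_two_pow (lt_of_lt_of_le ha h),
      Nat.testBit_lt_two_pow (lt_of_lt_of_le hb h), Bool.or_false, Bool.or_false]

end Ternary

theorem addBit_sound (c : ℤ) (m : ℕ) {p n : ℕ} (h : p &&& n = 0) (k : ℕ → ℕ → Bool) :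
    ∃ p' n', p' &&& n' = 0 ∧
      (∀ N φ, value N φ p' n' = value N φ p n + c • value N φ m 0) ∧
      addBit c m p n k = k p' n' := by
  have hc : ((c.emod 3).toNat : ZMod 3) = c := by
    have h1 : ((c.emod 3).toNat : ℤ) = c % 3 := Int.toNat_of_nonneg (Int.emod_nonneg _ (by norm_num))
    rw [← Int.cast_natCast, h1]
    exact (ZMod.intCast_eq_intCast_iff _ _ 3).2 (Int.mod_modEq c 3)
  have hlt : (c.emod 3).toNat < 3 := by
    have := Int.emod_lt_of_pos c (show (0 : ℤ) < 3 by norm_num)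
    have h' : c.emod 3 = c % 3 := rfl
    omega
  simp only [zsmul_eq_mul, ← hc, addBit]
  generalize (c.emod 3).toNat = d at hlt ⊢
  interval_cases d
  · exact ⟨p, n, h, by simp, rfl⟩
  · refine ⟨(p ^^^ m) ^^^ (n &&& m), n ^^^ ((p ||| n) &&& m), ?_, fun N φ => ?_, ?_⟩
    · apply Nat.eq_of_testBit_eq
      intro i
      have h1 := testBit_disj h i
      simp only [Nat.testBit_land, Nat.testBit_xor, Nat.testBit_lor, Nat.zero_testBit]
      generalize p.testBit i = a at *
      generalize n.testBit i = b at *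
      generalize m.testBit i = c at *
      revert a b c; decide
    · rw [value, value, value, Finset.mul_sum, ← Finset.sum_add_distrib]
      refine Finset.sum_congr rfl fun i _ => ?_
      rw [← mul_assoc, ← add_mul]
      congr 1
      have h1 := testBit_disj h i
      simp only [Nat.testBit_land, Nat.testBit_xor, Nat.testBit_lor, Nat.zero_testBit]
      generalize p.testBit i = a at *
      generalize n.testBit i = b at *
      generalize m.testBit i = c at *
      revert a b c; decide
    · simp only [force_eq]; rfl
  · refine ⟨p ^^^ ((p ||| n) &&& m), (n ^^^ m) ^^^ (p &&& m), ?_, fun N φ => ?_, ?_⟩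
    · apply Nat.eq_of_testBit_eq
      intro i
      have h1 := testBit_disj h i
      simp only [Nat.testBit_land, Nat.testBit_xor, Nat.testBit_lor, Nat.zero_testBit]
      generalize p.testBit i = a at *
      generalize n.testBit i = b at *
      generalize m.testBit i = c at *
      revert a b c; decide
    · rw [value, value, value, Finset.mul_sum, ← Finset.sum_add_distrib]
      refine Finset.sum_congr rfl fun i _ => ?_
      rw [← mul_assoc, ← add_mul]
      congr 1
      have h1 := testBit_disj h i
      simp only [Nat.testBit_land, Nat.testBit_xor, Nat.testBit_lor, Nat.zero_testBit]
      generalize p.testBit i = a at *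
      generalize n.testBit i = b at *
      generalize m.testBit i = c at *
      revert a b c; decide
    · simp only [force_eq]; rfl

theorem addBits_sound {β : Type} (l : List β) (c : β → ℤ) (m : β → ℕ) {p n : ℕ}
    (h : p &&& n = 0) (k : ℕ → ℕ → Bool) :
    ∃ p' n', p' &&& n' = 0 ∧
      (∀ N φ, value N φ p' n' =
        value N φ p n + (l.map fun x => c x • value N φ (m x) 0).sum) ∧
      (List.rec (motive := fun _ => ℕ → ℕ → Bool) k
        (fun x _ ih p n => addBit (c x) (m x) p n ih) l : ℕ → ℕ → Bool) p n = k p' n' := by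
  induction l generalizing p n with
  | nil => exact ⟨p, n, h, by simp, rfl⟩
  | cons x l ih =>
    obtain ⟨p1, n1, h1, h2, h3⟩ := addBit_sound (c x) (m x) h
      (List.rec (motive := fun _ => ℕ → ℕ → Bool) k
        (fun x _ ih p n => addBit (c x) (m x) p n ih) l : ℕ → ℕ → Bool)
    obtain ⟨p2, n2, h4, h5, h6⟩ := ih h1
    refine ⟨p2, n2, h4, fun N φ => ?_, h3.trans h6⟩
    rw [h5, h2, List.map_cons, List.sum_cons, add_assoc]

/-- The bits of the monomials of class `κ - 14` represent the coefficients `ρ`. -/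
def Represents (N : ℕ) (ψ : ℕ → ZMod 3) (ρ : ℕ → ZMod 3) (κ : ℕ) : Prop :=
  ∀ e ∈ monomials 6 4, (monClass e + 14) % 26 = κ → value N ψ (bit e) 0 = ρ e

theorem rec_zero_eq (a d : ℕ) : (Nat.rec 0 (fun _ _ => a) d : ℕ) = if d = 0 then 0 else a := by
  cases d <;> rfl

/-- The transport term does not mix components, so its part of the row is computed once for each
monomial and then shifted to each component. Hence `N`, `ψ` and `ρ` are quantified after `p` and
`n`. -/
theorem diagBits_sound {r : ℕ} (hr : r ∈ monomials 6 4) (k : ℕ → ℕ → Bool) :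
    ∃ p n, p &&& n = 0 ∧ (∀ N ψ ρ, Represents N ψ ρ (monClass r) →
      value N ψ p n = quadSum ρ r + linSum ρ r) ∧ diagBits r k = k p n := by
  obtain ⟨p1, n1, h1, h2, h3⟩ := addBits_sound quadTerms
    (fun x => x.2.2.2 * ((digit r x.1 + 1 : ℕ) : ℤ))
    (fun x => (Nat.rec 0 (fun _ _ => Nat.rec 0 (fun _ _ => bit (Nat.add (Nat.sub
      (Nat.sub r (Nat.pow 5 x.2.1)) (Nat.pow 5 x.2.2.1)) (Nat.pow 5 x.1))) (digit r x.2.2.1))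
      (digit r x.2.1) : ℕ)) (show 0 &&& 0 = 0 from rfl)
    (List.rec (motive := fun _ => Nat → Nat → Bool) k
      (fun x _ ih p n => addBit (x.2.2 * ((digit r x.1 + 1 : ℕ) : ℤ)) (Nat.rec 0 (fun _ _ =>
        bit (Nat.add (Nat.sub r (Nat.pow 5 x.2.1)) (Nat.pow 5 x.1))) (digit r x.2.1)) p n ih)
      linTerms)
  obtain ⟨p2, n2, h4, h5, h6⟩ := addBits_sound linTerms
    (fun x => x.2.2 * ((digit r x.1 + 1 : ℕ) : ℤ))
    (fun x => (Nat.rec 0 (fun _ _ => bit (Nat.add (Nat.sub r (Nat.pow 5 x.2.1)) (Nat.pow 5 x.1)))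
      (digit r x.2.1) : ℕ)) h1 k
  refine ⟨p2, n2, h4, fun N ψ ρ hρ => ?_, h3.trans h6⟩
  rw [h5, h2, value_eq_zero_left, zero_add, quadSum, linSum]
  congr 2
  · refine List.map_congr_left fun x hx => ?_
    simp only [rec_zero_eq]
    split_ifs with ha hb
    · rw [value_eq_zero_left, smul_zero]
    · rw [value_eq_zero_left, smul_zero]
    · obtain ⟨h7, h8⟩ := quad_target r hr x hx ha hb
      exact congrArg _ (hρ _ ((mem_monomials (by norm_num)).2 h7) h8)
  · refine List.map_congr_left fun x hx => ?_
    simp only [rec_zero_eq]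
    split_ifs with ha
    · rw [value_eq_zero_left, smul_zero]
    · obtain ⟨h7, h8⟩ := lin_target r hr x hx ha
      exact congrArg _ (hρ _ ((mem_monomials (by norm_num)).2 h7) h8)

def Templates.Good (κ : ℕ) : Templates → Prop
  | .nil => True
  | .cons r p n d0 d1 d2 d3 d4 d5 d6 rest =>
    (r ∈ monomials 6 4 ∧ monClass r = κ ∧ p &&& n = 0 ∧
      (∀ N ψ ρ, Represents N ψ ρ κ → value N ψ p n = quadSum ρ r + linSum ρ r) ∧
      d0 = dbit r 0 ∧ d1 = dbit r 1 ∧ d2 = dbit r 2 ∧ d3 = dbit r 3 ∧ d4 = dbit r 4 ∧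
      d5 = dbit r 5 ∧ d6 = bit r) ∧ rest.Good κ

theorem mkTemplates_sound {κ : ℕ} {l : List ℕ}
    (hl : ∀ r ∈ l, r ∈ monomials 6 4 ∧ monClass r = κ) (k : Templates → Bool) :
    ∃ t : Templates, t.Good κ ∧ mkTemplates l k = k t := by
  have H : ∀ acc : Templates, acc.Good κ → ∃ t : Templates, t.Good κ ∧
      (List.rec (motive := fun _ => Templates → Bool) k (fun r _ ih acc =>
        force r fun r => diagBits r fun p n =>
        force (dbit r 0) fun d0 => force (dbit r 1) fun d1 => force (dbit r 2) fun d2 =>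
        force (dbit r 3) fun d3 => force (dbit r 4) fun d4 => force (dbit r 5) fun d5 =>
        force (bit r) fun d6 => ih (.cons r p n d0 d1 d2 d3 d4 d5 d6 acc)) l :
          Templates → Bool) acc = k t := by
    induction l with
    | nil => exact fun acc h => ⟨acc, h, rfl⟩
    | cons r l ih =>
      intro acc hacc
      obtain ⟨h1, h2⟩ := hl r List.mem_cons_self
      have ih := ih fun r hr => hl r (List.mem_cons_of_mem _ hr)
      simp only [force_eq] at ih ⊢
      obtain ⟨p, n, h3, h4, h5⟩ := diagBits_sound h1 fun p n =>
        (List.rec (motive := fun _ => Templates → Bool) k (fun r _ ih acc => diagBits r fun p n =>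
          ih (.cons r p n (dbit r 0) (dbit r 1) (dbit r 2) (dbit r 3) (dbit r 4) (dbit r 5) (bit r)
            acc)) l : Templates → Bool) (.cons r p n (dbit r 0) (dbit r 1) (dbit r 2) (dbit r 3)
              (dbit r 4) (dbit r 5) (bit r) acc)
      rw [h5]
      rw [h2] at h4
      exact ih _ ⟨⟨h1, h2, h3, h4, rfl, rfl, rfl, rfl, rfl, rfl, rfl⟩, hacc⟩
  exact H .nil trivial

theorem mkTable_sound (c : ℕ) (k : TemplateTable → Bool) :
    ∃ t, (∀ i, (getTemplates t i).Good i) ∧ mkTable c k = k t := by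
  -- The classes are treated in decreasing order: with `c` classes still to come, entry `i` of the
  -- accumulator belongs to class `c + i`.
  have H : ∀ acc : TemplateTable, (∀ i, (getTemplates acc i).Good (c + i)) →
      ∃ t, (∀ i, (getTemplates t i).Good i) ∧
      (Nat.rec (motive := fun _ => TemplateTable → Bool) k (fun c ih acc =>
        mkTemplates ((monomials 6 4).filter fun r => Nat.beq (monClass r) c)
          fun l => ih (.cons l acc)) c : TemplateTable → Bool) acc = k t := by
    induction c with
    | zero => exact fun acc h => ⟨acc, fun i => by simpa using h i, rfl⟩
    | succ c ih =>
      intro acc hacc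
      obtain ⟨l, h1, h2⟩ := mkTemplates_sound (κ := c)
        (l := (monomials 6 4).filter fun r => Nat.beq (monClass r) c)
        (fun r hr => by
          rw [List.mem_filter] at hr
          exact ⟨hr.1, Nat.eq_of_beq_eq_true hr.2⟩)
        fun l => (Nat.rec (motive := fun _ => TemplateTable → Bool) k (fun c ih acc =>
          mkTemplates ((monomials 6 4).filter fun r => Nat.beq (monClass r) c)
            fun l => ih (.cons l acc)) c : TemplateTable → Bool) (.cons l acc)
      obtain ⟨t, h3, h4⟩ := ih (.cons l acc) fun i => by
        cases i with
        | zero => exact h1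
        | succ i =>
          have := hacc i
          rw [show c + 1 + i = c + (i + 1) by omega] at this
          exact this
      exact ⟨t, h3, h2.trans h4⟩
  refine H .nil fun i => ?_
  cases i <;> trivial

def actsOf (off : ℕ → ℕ) : List (ℕ × ℤ × ℕ) → Acts
  | [] => .nil
  | x :: l => .cons x.1 x.2.1 (off x.2.2) (actsOf off l)

theorem mkActs_eq (l : List (ℕ × ℤ × ℕ)) (off : ℕ → ℕ) (k : Acts → Bool) :
    mkActs l off k = k (actsOf off l) := by
  induction l generalizing k with
  | nil => rfl
  | cons x l ih =>
    have e : mkActs (x :: l) off k = force (off x.2.2) fun o => force x.1 fun i =>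
      mkActs l off fun a => k (.cons i x.2.1 o a) := rfl
    rw [e, force_eq, force_eq, ih]
    rfl

theorem actRow_sound {N : ℕ} {φ : ℕ → ZMod 3} {off : ℕ → ℕ} {l : List (ℕ × ℤ × ℕ)}
    {d0 d1 d2 d3 d4 d5 d6 : ℕ} {F : ℕ × ℤ × ℕ → ZMod 3}
    (hF : ∀ x ∈ l, value N φ ((pick d0 d1 d2 d3 d4 d5 d6 x.1) <<< off x.2.2) 0 = F x)
    {p n : ℕ} (h : p &&& n = 0) (k : ℕ → ℕ → Bool) :
    ∃ p' n', p' &&& n' = 0 ∧ value N φ p' n' = value N φ p n + (l.map fun x => x.2.1 • F x).sum ∧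
      actRow (actsOf off l) d0 d1 d2 d3 d4 d5 d6 p n k = k p' n' := by
  induction l generalizing p n with
  | nil => exact ⟨p, n, h, by simp, rfl⟩
  | cons x l ih =>
    have hx := hF x List.mem_cons_self
    have ih := fun {p n : ℕ} => ih (p := p) (n := n) fun y hy => hF y (List.mem_cons_of_mem _ hy)
    have e : actRow (actsOf off (x :: l)) d0 d1 d2 d3 d4 d5 d6 p n k =
      (fun m => ifZero m (actRow (actsOf off l) d0 d1 d2 d3 d4 d5 d6 p n k)
        (addBit x.2.1 (Nat.shiftLeft m (off x.2.2)) p n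
          fun p n => actRow (actsOf off l) d0 d1 d2 d3 d4 d5 d6 p n k))
        (pick d0 d1 d2 d3 d4 d5 d6 x.1) := rfl
    rw [e, List.map_cons, List.sum_cons]
    simp only [ifZero_eq]
    split_ifs with h0
    · obtain ⟨p', n', h1, h2, h3⟩ := ih h
      refine ⟨p', n', h1, ?_, h3⟩
      rw [h2, ← hx, h0, Nat.zero_shiftLeft, value_eq_zero_left, smul_zero, zero_add]
    · obtain ⟨p1, n1, h1, h2, h3⟩ := addBit_sound x.2.1
        (Nat.shiftLeft (pick d0 d1 d2 d3 d4 d5 d6 x.1) (off x.2.2)) h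
        fun p n => actRow (actsOf off l) d0 d1 d2 d3 d4 d5 d6 p n k
      obtain ⟨p', n', h4, h5, h6⟩ := ih h1
      refine ⟨p', n', h4, ?_, h3.trans h6⟩
      have h7 := h2 N φ
      rw [show Nat.shiftLeft (pick d0 d1 d2 d3 d4 d5 d6 x.1) (off x.2.2) =
        (pick d0 d1 d2 d3 d4 d5 d6 x.1) <<< off x.2.2 from rfl, hx] at h7
      rw [h5, h7, add_assoc]

/-! ### The numbering of the unknowns of one class -/

/-- The class of monomials that complete the slot code `J` to an unknown of class `c`. -/
def restClass (q c J : ℕ) : ℕ := Nat.mod (Nat.sub (Nat.add c 78) (slotClass q J)) 26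

def segment (q c : ℕ) (τ : ℕ → ℕ → ZMod 3) (J : ℕ) : List (ZMod 3) :=
  (classList (restClass q c J)).map (τ J)

def unknowns (q c : ℕ) (τ : ℕ → ℕ → ZMod 3) (n : ℕ) : List (ZMod 3) :=
  List.replicate 64 0 ++ (List.range n).flatMap (segment q c τ)

theorem unknowns_succ (q c : ℕ) (τ : ℕ → ℕ → ZMod 3) (n : ℕ) :
    unknowns q c τ (n + 1) = unknowns q c τ n ++ segment q c τ n := by
  simp [unknowns, List.range_succ, List.flatMap_append]

theorem classSize_eq (q c J : ℕ) (τ : ℕ → ℕ → ZMod 3) :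
    classSize q c J = (segment q c τ J).length := by
  have h := sizeTable_spec (restClass q c J) (Nat.mod_lt _ (by norm_num))
  rw [segment, List.length_map, ← h]
  rfl

theorem unknowns_length {q c O n : ℕ} (τ : ℕ → ℕ → ZMod 3) (h : checkOffsets q c O n = true)
    {m : ℕ} (hm : m ≤ n) : (unknowns q c τ m).length = offset O m := by
  have H : ∀ n, checkOffsets q c O n = true → (unknowns q c τ n).length = offset O n ∧
      (∀ m ≤ n, checkOffsets q c O m = true) := by
    intro n
    induction n with
    | zero =>
      intro h
      refine ⟨?_, fun m hm => by rwa [Nat.le_zero.1 hm]⟩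
      have h' : offset O 0 = 64 := Nat.eq_of_beq_eq_true h
      rw [h']; simp [unknowns]
    | succ n ih =>
      intro h
      have e : checkOffsets q c O (n + 1) = Bool.rec false (checkOffsets q c O n)
        (Nat.beq (offset O (Nat.succ n)) (Nat.add (offset O n) (classSize q c n))) := rfl
      have h0 := h
      rw [e] at h
      cases h1 : Nat.beq (offset O (Nat.succ n)) (Nat.add (offset O n) (classSize q c n))
      · rw [h1] at h; cases h
      · rw [h1] at h
        obtain ⟨h2, h3⟩ := ih h
        refine ⟨?_, fun m hm => ?_⟩
        · rw [unknowns_succ, List.length_append, h2, ← classSize_eq]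
          exact (Nat.eq_of_beq_eq_true h1).symm
        · rcases Nat.lt_or_ge n m with h4 | h4
          · rwa [show m = n + 1 by omega]
          · exact h3 m h4
  exact (H m ((H n h).2 m hm)).1

theorem unknowns_getD {q c n J : ℕ} (τ : ℕ → ℕ → ZMod 3) (hJ : J < n) {i : ℕ}
    (hi : i < (segment q c τ J).length) :
    (unknowns q c τ n).getD (i + (unknowns q c τ J).length) 0 = (segment q c τ J).getD i 0 := by
  induction n with
  | zero => omega
  | succ n ih =>
    rw [unknowns_succ]
    rcases Nat.lt_or_ge J n with h | h
    · rw [← ih h]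
      have : (unknowns q c τ (J + 1)).length ≤ (unknowns q c τ n).length := by
        clear ih hJ
        induction n with
        | zero => omega
        | succ n ih =>
          rcases Nat.lt_or_ge J n with h' | h'
          · rw [unknowns_succ q c τ n, List.length_append]
            exact (ih h').trans (Nat.le_add_right _ _)
          · rw [show n = J by omega]
      rw [unknowns_succ, List.length_append] at this
      exact List.getD_append _ _ _ _ (by omega)
    · obtain rfl : J = n := by omega
      rw [List.getD_append_right _ _ _ _ (by omega)]
      congr 1; omega

/-- The bound `q ≤ 5` gives slot weights at most `15 * 5 = 75 ≤ 78`, so the natural subtraction in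
`restClass` is exact. -/
theorem restClass_eq {q c J e : ℕ} (hq : q ≤ 5) (h : (slotClass q J + monClass e) % 26 = c) :
    restClass q c J = monClass e := by
  have h1 := monClass_lt e
  have h2 := slotClass_le q J
  change (c + 78 - slotClass q J) % 26 = monClass e
  omega

/-- The numerical data of a single elimination problem. -/
structure Layout (q c : ℕ) (τ : ℕ → ℕ → ZMod 3) (N : ℕ) (φ : ℕ → ZMod 3) (off : ℕ → ℕ) : Prop where
  low : ∀ i < 64, φ i = 0
  high : ∀ i ≥ N, φ i = 0
  value : ∀ J < 6 ^ q, ∀ e ∈ monomials 6 4, (slotClass q J + monClass e) % 26 = c →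
    value N (fun i => φ (i + off J)) (bit e) 0 = τ J e

theorem layout_of_check {q c O : ℕ} (hq : q ≤ 5) {τ : ℕ → ℕ → ZMod 3}
    (hτ : ∀ J e, ¬(J < 6 ^ q ∧ e ∈ monomials 6 3) → τ J e = 0)
    (h : checkOffsets q c O (6 ^ q) = true) :
    Layout q c τ (offset O (6 ^ q)) (fun i => (unknowns q c τ (6 ^ q)).getD i 0) (offset O) where
  low i hi := by
    rw [unknowns, List.getD_append _ _ _ _ (by simpa using hi)]
    exact List.getD_replicate _ hi
  high i hi := by
    rw [← unknowns_length τ h le_rfl] at hi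
    exact List.getD_eq_default _ _ hi
  value J hJ e he hc := by
    have hN : ∀ i ≥ offset O (6 ^ q),
        (fun i => (unknowns q c τ (6 ^ q)).getD (i + offset O J) 0) i = 0 := by
      intro i hi
      rw [← unknowns_length τ h le_rfl] at hi
      exact List.getD_eq_default _ _ (by omega)
    rcases lookup_spec e he with ⟨h1, h2⟩ | ⟨h1, h2⟩
    · rw [hτ J e fun h3 => by rw [(mem_monomials (by norm_num)).1 h3.2] at h2; cases h2]
      rw [bit, h1]
      exact value_eq_zero_left _ _
    · obtain ⟨i, hi⟩ := Nat.exists_eq_succ_of_ne_zero h1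
      rw [hi, Nat.succ_sub_one] at h2
      have hb : bit e = 1 <<< i := by rw [bit, hi]; rfl
      rw [hb, value_one_shiftLeft hN]
      have h3 : (segment q c τ J)[i]? = some (τ J e) := by
        rw [segment, restClass_eq hq hc, List.getElem?_map, h2]; rfl
      obtain ⟨h4, h5⟩ := List.getElem?_eq_some_iff.1 h3
      rw [← unknowns_length τ h hJ.le, unknowns_getD τ hJ h4, List.getD_eq_getElem _ _ h4, h5]

theorem Layout.represents {q c : ℕ} (hq : q ≤ 5) {τ : ℕ → ℕ → ZMod 3} {N : ℕ} {φ : ℕ → ZMod 3}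
    {off : ℕ → ℕ} (hL : Layout q c τ N φ off) (hc : c < 26) {J : ℕ} (hJ : J < 6 ^ q) :
    Represents N (fun i => φ (i + off J)) (τ J) ((c + 92 - slotClass q J) % 26) := by
  intro e he h
  apply hL.value J hJ e he
  have h1 := monClass_lt e
  have h2 := slotClass_le q J
  omega

/-- Slot codes stay in range and the equations are homogeneous. -/
def SlotsHomogeneous (q : ℕ) : Prop :=
  ∀ J < 6 ^ q, ∀ x ∈ slotList J q, x.2.2 < 6 ^ q ∧ x.1 ≤ 6 ∧
    (slotClass q x.2.2 + 14) % 26 = (slotClass q J + if x.1 = 6 then 0 else wt x.1) % 26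

theorem value_pick {q c : ℕ} (hq : q ≤ 5) (hs : SlotsHomogeneous q) {τ : ℕ → ℕ → ZMod 3} {N : ℕ}
    {φ : ℕ → ZMod 3} {off : ℕ → ℕ} (hL : Layout q c τ N φ off) (hc : c < 26) {J : ℕ}
    (hJ : J < 6 ^ q) {r : ℕ} (hr : r ∈ monomials 6 4)
    (hcr : monClass r = (c + 92 - slotClass q J) % 26) {x : ℕ × ℤ × ℕ} (hx : x ∈ slotList J q) :
    value N φ ((pick (dbit r 0) (dbit r 1) (dbit r 2) (dbit r 3) (dbit r 4) (dbit r 5) (bit r) x.1)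
      <<< off x.2.2) 0 = shifted (τ x.2.2) r x.1 := by
  obtain ⟨h1, h2, h3⟩ := hs J hJ x hx
  have h4 := slotClass_le q J
  have h5 := slotClass_le q x.2.2
  have h6 := monClass_lt r
  have e : pick (dbit r 0) (dbit r 1) (dbit r 2) (dbit r 3) (dbit r 4) (dbit r 5) (bit r) x.1 =
      if x.1 = 6 then bit r else dbit r x.1 := by
    generalize x.1 = i at h2
    interval_cases i <;> rfl
  have e0 : (0 : ℕ) = 0 <<< off x.2.2 := (Nat.zero_shiftLeft _).symm
  rw [e]
  conv_lhs => rw [e0]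
  rw [value_shiftLeft hL.high, shifted]
  by_cases h7 : x.1 = 6
  · rw [if_pos h7, if_pos h7]
    rw [if_pos h7] at h3
    exact hL.value _ h1 r hr (by omega)
  · rw [if_neg h7, if_neg h7, dbit, rec_zero_eq]
    rw [if_neg h7] at h3
    split_ifs with h8
    · exact value_eq_zero_left _ _
    · obtain ⟨h9, h10⟩ := shift_target r hr x.1 (by omega) h8
      have h11 : wt x.1 ≤ 15 := by unfold wt; split <;> omega
      have h12 := monClass_lt (r - 5 ^ x.1)
      change value N (fun i => φ (i + off x.2.2)) (bit (r - 5 ^ x.1)) 0 = _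
      exact hL.value _ h1 _ ((mem_monomials (by norm_num)).2 h9) (by omega)

theorem genSlot_sound {q c : ℕ} (hq : q ≤ 5) (hs : SlotsHomogeneous q) {τ : ℕ → ℕ → ZMod 3}
    (hτ : System q τ) {N : ℕ} {φ : ℕ → ZMod 3} {off : ℕ → ℕ} (hL : Layout q c τ N φ off)
    (hc : c < 26) {J : ℕ} (hJ : J < 6 ^ q) {t : Templates}
    (ht : t.Good ((c + 92 - slotClass q J) % 26)) {rows : Rows} (hr : rows.All (Valid N φ))
    (k : Rows → Bool) :
    ∃ rows' : Rows, rows'.All (Valid N φ) ∧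
      genSlot (off J) (actsOf off (slotList J q)) t rows k = k rows' := by
  induction t generalizing rows with
  | nil => exact ⟨rows, hr, rfl⟩
  | cons r p n d0 d1 d2 d3 d4 d5 d6 rest ih =>
    obtain ⟨⟨h1, h2, h3, h4, rfl, rfl, rfl, rfl, rfl, rfl, rfl⟩, hrest⟩ := ht
    have ih := fun {rows : Rows} => ih (rows := rows) hrest
    set P := (p <<< off J) ||| (0x5555555555555555 &&& ((off J + r * 4099) * 0x9E3779B97F4A7C15))
      with hP
    set Q := (n <<< off J) ||| (0xAAAAAAAAAAAAAAAA &&& ((off J + r * 4099) * 0x9E3779B97F4A7C15))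
      with hQ
    have e : genSlot (off J) (actsOf off (slotList J q)) (.cons r p n (dbit r 0) (dbit r 1)
        (dbit r 2) (dbit r 3) (dbit r 4) (dbit r 5) (bit r) rest) rows k =
      force P fun p => force Q fun n => ifZero (Nat.land p n)
        (actRow (actsOf off (slotList J q)) (dbit r 0) (dbit r 1) (dbit r 2) (dbit r 3) (dbit r 4)
          (dbit r 5) (bit r) p n fun p n => ifZero (Nat.shiftRight (Nat.lor p n) 64)
            (genSlot (off J) (actsOf off (slotList J q)) rest rows k)
            (genSlot (off J) (actsOf off (slotList J q)) rest (.cons p n rows) k))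
        (genSlot (off J) (actsOf off (slotList J q)) rest rows k) := rfl
    rw [e]
    simp only [force_eq]
    rw [ifZero_eq]
    -- The program tests the disjointness of the masks itself, so it need not be proved; a row that
    -- failed the test would just be dropped.
    split_ifs with h5
    · obtain ⟨p', n', h6, h7, h8⟩ := actRow_sound (N := N) (φ := φ) (off := off)
        (l := slotList J q) (F := fun x => shifted (τ x.2.2) r x.1)
        (fun x hx => value_pick hq hs hL hc hJ h1 h2 hx) h5
        fun p n => ifZero (Nat.shiftRight (Nat.lor p n) 64)
            (genSlot (off J) (actsOf off (slotList J q)) rest rows k)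
            (genSlot (off J) (actsOf off (slotList J q)) rest (.cons p n rows) k)
      rw [h8, ifZero_eq]
      split_ifs
      · exact ih hr
      · refine ih ⟨⟨h6, ?_⟩, hr⟩
        rw [h7, ← hτ.eqn J hJ r h1, ← h4 N _ _ (hL.represents hq hc hJ), slotSum, hP, hQ,
          value_lor hL.low, value_shiftLeft hL.high]
        · exact lt_of_le_of_lt Nat.and_le_left (by norm_num)
        · exact lt_of_le_of_lt Nat.and_le_left (by norm_num)
    · exact ih hr

theorem generate_sound {q c : ℕ} (hq : q ≤ 5) (hs : SlotsHomogeneous q) {τ : ℕ → ℕ → ZMod 3}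
    (hτ : System q τ) {N : ℕ} {φ : ℕ → ZMod 3} {off : ℕ → ℕ} (hL : Layout q c τ N φ off)
    (hc : c < 26) {t : TemplateTable} (ht : ∀ i, (getTemplates t i).Good i) {rows : Rows}
    (hr : rows.All (Valid N φ)) (k : Rows → Bool) :
    ∃ rows' : Rows, rows'.All (Valid N φ) ∧ generate q c off t rows k = k rows' := by
  have H : ∀ n ≤ 6 ^ q, ∀ rows : Rows, rows.All (Valid N φ) →
      ∃ rows' : Rows, rows'.All (Valid N φ) ∧
      (Nat.rec (motive := fun _ => Rows → Bool) k (fun J ih rows =>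
        mkActs (slotList J q) off fun a => force (off J) fun o =>
          genSlot o a (getTemplates t (Nat.mod (Nat.sub (Nat.add c 92) (slotClass q J)) 26)) rows
            ih) n : Rows → Bool) rows = k rows' := by
    intro n
    induction n with
    | zero => exact fun _ rows hr => ⟨rows, hr, rfl⟩
    | succ n ih =>
      intro hn rows hr
      have ih := ih (by omega)
      simp only [mkActs_eq, force_eq] at ih ⊢
      obtain ⟨rows', h1, h2⟩ := genSlot_sound hq hs hτ hL hc (show n < 6 ^ q by omega)
        (ht ((c + 92 - slotClass q n) % 26)) hr
        (Nat.rec (motive := fun _ => Rows → Bool) k (fun J ih rows =>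
          genSlot (off J) (actsOf off (slotList J q))
            (getTemplates t (Nat.mod (Nat.sub (Nat.add c 92) (slotClass q J)) 26)) rows ih) n)
      obtain ⟨rows'', h3, h4⟩ := ih rows' h1
      exact ⟨rows'', h3, h2.trans h4⟩
  exact H _ le_rfl rows hr

theorem normalRows_sound {q c : ℕ} (hn : ∀ x ∈ normals q, x.1 < 6 ^ q ∧ isMonomial 6 4 x.2 = true)
    {τ : ℕ → ℕ → ZMod 3} (hτ : System q τ) {N : ℕ} {φ : ℕ → ZMod 3} {off : ℕ → ℕ}
    (hL : Layout q c τ N φ off) {rows : Rows} (hr : rows.All (Valid N φ)) (k : Rows → Bool) :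
    ∃ rows' : Rows, rows'.All (Valid N φ) ∧ normalRows q c off rows k = k rows' := by
  have H : ∀ l : List (ℕ × ℕ), (∀ x ∈ l, x ∈ normals q) → ∀ rows : Rows, rows.All (Valid N φ) →
      ∃ rows' : Rows, rows'.All (Valid N φ) ∧
      (List.rec (motive := fun _ => Rows → Bool) k (fun x _ ih rows =>
        Bool.rec (ih rows) (force (Nat.shiftLeft (bit x.2) (off x.1)) fun p => ih (.cons p 0 rows))
        (Nat.beq (Nat.mod (Nat.add (slotClass q x.1) (monClass x.2)) 26) c)) l :
          Rows → Bool) rows = k rows' := by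
    intro l
    induction l with
    | nil => exact fun _ rows hr => ⟨rows, hr, rfl⟩
    | cons x l ih =>
      intro hl rows hr
      have ih := ih fun y hy => hl y (List.mem_cons_of_mem _ hy)
      simp only [force_eq] at ih ⊢
      cases h : Nat.beq (Nat.mod (Nat.add (slotClass q x.1) (monClass x.2)) 26) c
      · exact ih rows hr
      · refine ih _ ⟨⟨Nat.and_zero _, ?_⟩, hr⟩
        have hx := hl x List.mem_cons_self
        obtain ⟨h1, h2⟩ := hn x hx
        have h3 := hL.value x.1 h1 x.2 ((mem_monomials (by norm_num)).2 h2)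
          (Nat.eq_of_beq_eq_true h)
        rw [hτ.normal x hx, ← value_shiftLeft hL.high, Nat.zero_shiftLeft] at h3
        exact h3
  exact H _ (fun _ h => h) rows hr

/-- Nothing has to be known about the table `O`: it is a mere proposal that `checkOffsets` certifies
afterwards. -/
theorem mkOffsets_eq (q c n : ℕ) (k : ℕ → Bool) : ∃ O, mkOffsets q c n k = k O := by
  have H : ∀ J o O, ∃ O', (Nat.rec (motive := fun _ => Nat → Nat → Nat → Bool) (fun _ _ O => k O)
      (fun _ ih J o O => force (Nat.lor O (Nat.shiftLeft o (Nat.mul 16 J))) fun O =>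
      force (Nat.add o (classSize q c J)) fun o => force (Nat.add J 1) fun J => ih J o O) n :
        ℕ → ℕ → ℕ → Bool) J o O = k O' := by
    induction n with
    | zero => exact fun J o O => ⟨O, rfl⟩
    | succ n ih =>
      intro J o O
      simp only [force_eq] at ih ⊢
      exact ih _ _ _
  exact H 0 64 0

theorem monomials_mono : ∀ e ∈ monomials 6 3, isMonomial 6 4 e = true := by
  decide +kernel

/-- The solution `τ` is laid out as a vector `φ` of unknowns. Generated and normalising rows are
equations for `φ`, so a successful elimination kills all of `φ`, and each `τ J e` of the class is
one of its entries. -/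
theorem eq_zero_of_solve {q c : ℕ} (hq : q ≤ 5) (hs : SlotsHomogeneous q)
    (hn : ∀ x ∈ normals q, x.1 < 6 ^ q ∧ isMonomial 6 4 x.2 = true)
    {τ : ℕ → ℕ → ZMod 3} (hτ : System q τ) (hc : c < 26) {cs : List ℕ}
    (h : solve q c cs = true) {J e : ℕ} (hJ : J < 6 ^ q) (he : e ∈ monomials 6 3)
    (hJe : (slotClass q J + monClass e) % 26 = c) : τ J e = 0 := by
  rw [solve] at h
  obtain ⟨t, h1, h2⟩ := mkTable_sound 26 fun t => mkOffsets q c (Nat.add (Nat.pow 6 q) 1) fun O =>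
    Bool.rec false (generate q c (offset O) t .nil fun rows =>
      normalRows q c (offset O) rows fun rows =>
      eliminate cs rows (Nat.sub (Nat.pow 2 (offset O (Nat.pow 6 q))) 1))
      (checkOffsets q c O (Nat.pow 6 q))
  rw [h2] at h
  obtain ⟨O, h3⟩ := mkOffsets_eq q c (Nat.add (Nat.pow 6 q) 1) fun O =>
    Bool.rec false (generate q c (offset O) t .nil fun rows =>
      normalRows q c (offset O) rows fun rows =>
      eliminate cs rows (Nat.sub (Nat.pow 2 (offset O (Nat.pow 6 q))) 1))
      (checkOffsets q c O (Nat.pow 6 q))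
  rw [h3] at h
  cases h4 : checkOffsets q c O (Nat.pow 6 q)
  · rw [h4] at h; cases h
  rw [h4] at h
  have hL := layout_of_check hq hτ.supp h4
  obtain ⟨rows, h5, h6⟩ := generate_sound hq hs hτ hL hc h1 (rows := .nil) trivial fun rows =>
      normalRows q c (offset O) rows fun rows =>
      eliminate cs rows (Nat.sub (Nat.pow 2 (offset O (Nat.pow 6 q))) 1)
  obtain ⟨rows', h7, h8⟩ := normalRows_sound hn hτ hL h5 fun rows =>
      eliminate cs rows (Nat.sub (Nat.pow 2 (offset O (Nat.pow 6 q))) 1)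
  have h9 := eliminate_sound hL.low hL.high cs h7 (u := 2 ^ offset O (6 ^ q) - 1)
    (fun i hi => hL.high i (by
      rw [Nat.testBit_two_pow_sub_one] at hi
      simpa using hi)) (((h6.trans h8).symm.trans h) : _)
  have he4 := (mem_monomials le_rfl).2 (monomials_mono e he)
  rw [← hL.value J hJ e he4 hJe]
  simp only [h9, value, mul_zero, Finset.sum_const_zero]

/-! ### The computation over the field with three elements -/

/-- Bounds for the length of the pivot rows in successive elimination passes. -/
def caps : List ℕ := [1, 3, 3, 3, 3, 3, 4, 4, 5, 5, 6, 6, 7, 8]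

set_option maxHeartbeats 0 in
set_option maxRecDepth 100000000 in
-- This is the computational core: in each of the 26 classes the normalised system has full column
-- rank modulo 3. The classes are distributed over several kernel evaluations.
theorem solve_eq_true {q c : ℕ} (hq : q = 2 ∨ q = 3) (hc : c < 26) : solve q c caps = true := by
  have h2 : ∀ c < 26, solve 2 c caps = true := by decide +kernel
  have light : ∀ c ∈ [0, 1, 2, 3, 4, 5, 6, 7, 13, 14, 15, 16, 17, 18, 19],
    solve 3 c caps = true := by decide +kernel
  have border : ∀ c ∈ [10, 11, 12, 24, 25], solve 3 c caps = true := by decide +kernel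
  have h8 : solve 3 8 caps = true := by decide +kernel
  have h9 : solve 3 9 caps = true := by decide +kernel
  have h20 : solve 3 20 caps = true := by decide +kernel
  have h21 : solve 3 21 caps = true := by decide +kernel
  have h22 : solve 3 22 caps = true := by decide +kernel
  have h23 : solve 3 23 caps = true := by decide +kernel
  rcases hq with rfl | rfl
  · exact h2 c hc
  have h1 := light c
  have h3 := border c
  simp only [List.mem_cons, List.not_mem_nil, or_false] at h1 h3
  by_cases h4 : c = 10 ∨ c = 11 ∨ c = 12 ∨ c = 24 ∨ c = 25
  · exact h3 h4
  rcases (by omega : c = 8 ∨ c = 9 ∨ c = 20 ∨ c = 21 ∨ c = 22 ∨ c = 23 ∨ (c ≠ 8 ∧ c ≠ 9 ∧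
    c ≠ 20 ∧ c ≠ 21 ∧ c ≠ 22 ∧ c ≠ 23)) with rfl | rfl | rfl | rfl | rfl | rfl | h
  · exact h8
  · exact h9
  · exact h20
  · exact h21
  · exact h22
  · exact h23
  · exact h1 (by omega)

theorem slotsHomogeneous {q : ℕ} (hq : q = 2 ∨ q = 3) : SlotsHomogeneous q := by
  rcases hq with rfl | rfl <;> · unfold SlotsHomogeneous; decide +kernel

theorem normals_lt {q : ℕ} (hq : q = 2 ∨ q = 3) :
    ∀ x ∈ normals q, x.1 < 6 ^ q ∧ isMonomial 6 4 x.2 = true := by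
  rcases hq with rfl | rfl <;> decide +kernel

theorem System.eq_zero_mod_three {q : ℕ} (hq : q = 2 ∨ q = 3) {τ : ℕ → ℕ → ZMod 3}
    (hτ : System q τ) : τ = 0 := by
  funext J e
  by_cases h : J < 6 ^ q ∧ e ∈ monomials 6 3
  · have hc : (slotClass q J + monClass e) % 26 < 26 := Nat.mod_lt _ (by norm_num)
    exact eq_zero_of_solve (by omega) (slotsHomogeneous hq) (normals_lt hq) hτ hc
      (solve_eq_true hq hc) h.1 h.2 rfl
  · exact hτ.supp J e h

/-! ### From the field with three elements to the integers and the reals -/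

section Transfer
variable {A B : Type*} [AddCommGroup A] [AddCommGroup B] (f : A →+ B)

theorem quadSum_map (ρ : ℕ → A) (r : ℕ) : quadSum (fun e => f (ρ e)) r = f (quadSum ρ r) := by
  rw [quadSum, quadSum, map_list_sum, List.map_map]
  congr 2; funext x
  simp only [Function.comp_apply]
  split_ifs <;> simp only [map_zero, map_zsmul]

theorem linSum_map (ρ : ℕ → A) (r : ℕ) : linSum (fun e => f (ρ e)) r = f (linSum ρ r) := by
  rw [linSum, linSum, map_list_sum, List.map_map]
  congr 2; funext x
  simp only [Function.comp_apply]
  split_ifs <;> simp only [map_zero, map_zsmul]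

theorem slotSum_map (τ : ℕ → ℕ → A) (q J r : ℕ) :
    slotSum (fun J e => f (τ J e)) q J r = f (slotSum τ q J r) := by
  rw [slotSum, slotSum, map_list_sum, List.map_map]
  congr 2; funext x
  simp only [Function.comp_apply, shifted]
  split_ifs <;> simp only [map_zero, map_zsmul, smul_zero]

theorem System.map {q : ℕ} {τ : ℕ → ℕ → A} (h : System q τ) : System q fun J e => f (τ J e) where
  eqn J hJ r hr := by
    rw [quadSum_map, linSum_map, slotSum_map, ← map_add, ← map_add, h.eqn J hJ r hr, map_zero]
  supp J e he := by rw [h.supp J e he, map_zero]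
  normal x hx := by rw [h.normal x hx, map_zero]

theorem System.of_map {q : ℕ} {τ : ℕ → ℕ → A} (hf : Function.Injective f)
    (h : System q fun J e => f (τ J e)) : System q τ where
  eqn J hJ r hr := hf <| by
    rw [map_zero, map_add, map_add, ← quadSum_map, ← linSum_map, ← slotSum_map, h.eqn J hJ r hr]
  supp J e he := hf <| by rw [h.supp J e he, map_zero]
  normal x hx := hf <| by rw [h.normal x hx, map_zero]

end Transfer

/-- Infinite descent: a solution vanishes modulo 3, and its quotient by 3 is again a solution, so
every entry is divisible by all powers of 3. -/
theorem System.eq_zero_int {q : ℕ} (hq : q = 2 ∨ q = 3) {τ : ℕ → ℕ → ℤ} (hτ : System q τ) :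
    τ = 0 := by
  have H : ∀ n : ℕ, ∃ σ : ℕ → ℕ → ℤ, System q σ ∧ ∀ J e, τ J e = 3 ^ n * σ J e := by
    intro n
    induction n with
    | zero => exact ⟨τ, hτ, fun J e => by simp⟩
    | succ n ih =>
      obtain ⟨σ, h1, h2⟩ := ih
      have h3 := (h1.map (Int.castAddHom (ZMod 3))).eq_zero_mod_three hq
      have h4 : ∀ J e, ∃ k : ℤ, σ J e = 3 * k := fun J e =>
        (ZMod.intCast_zmod_eq_zero_iff_dvd (σ J e) 3).1 (congrFun (congrFun h3 J) e)
      choose ρ hρ using h4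
      refine ⟨ρ, System.of_map (AddMonoidHom.mulLeft (3 : ℤ))
        (fun x y h => by simpa using h) ?_, fun J e => by rw [h2, hρ, pow_succ, mul_assoc]⟩
      convert h1 using 3 with J e
      exact (hρ J e).symm
  funext J e
  -- With `n = |τ J e|` the divisor `3 ^ n` exceeds `|τ J e|`, which forces the entry to be zero.
  obtain ⟨σ, -, h⟩ := H (τ J e).natAbs
  refine Int.eq_zero_of_abs_lt_dvd (m := 3 ^ (τ J e).natAbs) ⟨_, h J e⟩ ?_
  rw [Int.abs_eq_natAbs]
  exact_mod_cast Nat.lt_pow_self (by norm_num)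

/-- The finitely many entries of a solution span a finitely generated torsion-free group, hence a
free one. Each integer functional on it produces an integer solution, and these functionals separate
points. -/
theorem System.eq_zero {q : ℕ} (hq : q = 2 ∨ q = 3) {τ : ℕ → ℕ → ℝ} (hτ : System q τ) :
    τ = 0 := by
  let S : Set ℝ := insert 0 ((fun x : ℕ × ℕ => τ x.1 x.2) ''
    (Set.Iio (6 ^ q) ×ˢ {e | e ∈ monomials 6 3}))
  have hS : S.Finite := (Set.Finite.image _ ((Set.finite_Iio _).prod (List.finite_toSet _))).insert _
  let H := Submodule.span ℤ S
  have hfin : Module.Finite ℤ H := Module.Finite.iff_fg.2 (Submodule.fg_span hS)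
  have hmem : ∀ J e, τ J e ∈ H := by
    intro J e
    by_cases h : J < 6 ^ q ∧ e ∈ monomials 6 3
    · exact Submodule.subset_span (Set.mem_insert_of_mem _ ⟨(J, e), h, rfl⟩)
    · rw [hτ.supp J e h]; exact H.zero_mem
  let σ : ℕ → ℕ → H := fun J e => ⟨τ J e, hmem J e⟩
  have hσ : System q σ := System.of_map H.subtype.toAddMonoidHom H.injective_subtype hτ
  funext J e
  have h0 : σ J e = 0 := by
    refine (Module.forall_dual_apply_eq_zero_iff ℤ _).1 fun f => ?_
    exact congrFun (congrFun ((hσ.map f.toAddMonoidHom).eq_zero_int hq) J) e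
  exact congrArg Subtype.val h0

/-! ### The coefficients of the Lie derivative of a polynomial tensor field -/

open MvPolynomial

noncomputable def exponent (e : ℕ) : Fin 6 →₀ ℕ := Finsupp.equivFunOnFinite.symm fun i => digit e i

theorem exponent_apply (e : ℕ) (i : Fin 6) : exponent e i = digit e i := rfl

theorem slot_lt (J s : ℕ) : slot J s < 6 := Nat.mod_lt _ (by norm_num)

def slotIndex (q J : ℕ) : Fin q → Fin 6 := fun s => ⟨5 - slot J s, by omega⟩

noncomputable def fieldPoly (a : ℝ) : Fin 6 → MvPolynomial (Fin 6) ℝ :=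
  ![2 * X 2 * X 4 - 4 * X 1 * X 5,
    -2 * X 2 * X 3 + 4 * X 0 * X 5,
    2 * X 1 * X 3 - 2 * X 0 * X 4,
    -2 * X 4 * X 5,
    2 * X 3 * X 5 - C a * X 2,
    C a * X 1]

theorem digit_quad : ∀ r ∈ monomials 6 4, ∀ x ∈ quadTerms, digit r x.2.1 ≠ 0 →
    digit r x.2.2.1 ≠ 0 → ∀ v < 6, digit (r - 5 ^ x.2.1 - 5 ^ x.2.2.1 + 5 ^ x.1) v +
      ((if x.2.1 = v then 1 else 0) + if x.2.2.1 = v then 1 else 0) =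
      digit r v + if x.1 = v then 1 else 0 := by
  decide +kernel

theorem digit_lin : ∀ r ∈ monomials 6 4, ∀ x ∈ linTerms, digit r x.2.1 ≠ 0 →
    ∀ v < 6, digit (r - 5 ^ x.2.1 + 5 ^ x.1) v + (if x.2.1 = v then 1 else 0) =
      digit r v + if x.1 = v then 1 else 0 := by
  decide +kernel

theorem digit_shift : ∀ r ∈ monomials 6 4, ∀ i < 6, digit r i ≠ 0 →
    ∀ v < 6, digit (r - 5 ^ i) v + (if i = v then 1 else 0) = digit r v := by
  decide +kernel

theorem quadTerms_distinct : ∀ x ∈ quadTerms, x.1 < 6 ∧ x.2.1 < 6 ∧ x.2.2.1 < 6 ∧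
    x.1 ≠ x.2.1 ∧ x.1 ≠ x.2.2.1 ∧ x.2.1 ≠ x.2.2.1 := by
  decide

theorem linTerms_distinct : ∀ x ∈ linTerms, x.1 < 6 ∧ x.2.1 < 6 ∧ x.1 ≠ x.2.1 := by
  decide

theorem coeff_X_mul_exponent {r : ℕ} (hr : r ∈ monomials 6 4) (i : Fin 6)
    (P : MvPolynomial (Fin 6) ℝ) :
    coeff (exponent r) (X i * P) = if digit r i = 0 then 0 else coeff (exponent (r - 5 ^ (i : ℕ))) P := by
  rw [coeff_X_mul']
  simp only [Finsupp.mem_support_iff, exponent_apply, ne_eq, ite_not]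
  split_ifs with h
  · rfl
  · congr 2
    ext v
    have := digit_shift r hr i i.2 h v v.2
    rw [Finsupp.tsub_apply, Finsupp.single_apply, exponent_apply, exponent_apply, ← this]
    simp only [Fin.ext_iff]
    omega

theorem coeff_X_mul_pderiv {r : ℕ} (hr : r ∈ monomials 6 4) {i k : Fin 6}
    (hik : k ≠ i) (P : MvPolynomial (Fin 6) ℝ)
    (h : digit r i ≠ 0 → ∀ v < 6, digit (r - 5 ^ (i : ℕ) + 5 ^ (k : ℕ)) v +
      (if (i : ℕ) = v then 1 else 0) = digit r v + if (k : ℕ) = v then 1 else 0) :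
    coeff (exponent r) (X i * pderiv k P) = if digit r i = 0 then 0 else
      ((digit r k : ℝ) + 1) * coeff (exponent (r - 5 ^ (i : ℕ) + 5 ^ (k : ℕ))) P := by
  rw [coeff_X_mul_exponent hr]
  split_ifs with h0
  · rfl
  have h1 := h h0
  have h2 := digit_shift r hr i i.2 h0
  rw [coeff_pderiv]
  have e : exponent (r - 5 ^ (i : ℕ)) + Finsupp.single k 1 =
      exponent (r - 5 ^ (i : ℕ) + 5 ^ (k : ℕ)) := by
    ext v
    rw [Finsupp.add_apply, Finsupp.single_apply, exponent_apply, exponent_apply]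
    have := h1 v v.2
    have := h2 v v.2
    simp only [Fin.ext_iff]
    omega
  have h3 := h2 k k.2
  rw [if_neg (by simpa [Fin.ext_iff, eq_comm] using hik), add_zero] at h3
  rw [e, exponent_apply, h3, mul_comm]

/-- Since `i`, `j`, `k` are distinct, dividing `r` by `xᵢ` changes neither the exponent tested for
`xⱼ` nor the exponent of `xₖ` that gives the derivative factor. -/
theorem coeff_X_mul_X_mul_pderiv {r : ℕ} (hr : r ∈ monomials 6 4) {i j k : Fin 6}
    (hki : k ≠ i) (hkj : k ≠ j) (hij : i ≠ j) (P : MvPolynomial (Fin 6) ℝ)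
    (h : digit r i ≠ 0 → digit r j ≠ 0 → ∀ v < 6,
      digit (r - 5 ^ (i : ℕ) - 5 ^ (j : ℕ) + 5 ^ (k : ℕ)) v +
      ((if (i : ℕ) = v then 1 else 0) + if (j : ℕ) = v then 1 else 0) =
      digit r v + if (k : ℕ) = v then 1 else 0) :
    coeff (exponent r) (X i * (X j * pderiv k P)) = if digit r i = 0 then 0 else
      if digit r j = 0 then 0 else
      ((digit r k : ℝ) + 1) *
        coeff (exponent (r - 5 ^ (i : ℕ) - 5 ^ (j : ℕ) + 5 ^ (k : ℕ))) P := by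
  rw [coeff_X_mul_exponent hr]
  split_ifs with h0 h0'
  · rfl
  all_goals
    have hr' := (mem_monomials le_rfl).2 (shift_target r hr i i.2 h0).1
    have h2 := digit_shift r hr i i.2 h0
    have hj := h2 j j.2
    rw [if_neg (by simpa [Fin.ext_iff] using hij), add_zero] at hj
    have hk := h2 k k.2
    rw [if_neg (by simpa [Fin.ext_iff, eq_comm] using hki), add_zero] at hk
    rw [coeff_X_mul_pderiv hr' hkj]
  · rw [if_pos (by omega)]
  · intro h3; omega
  · rw [if_neg (by omega), hk]
  · intro _ v hv
    have := h h0 h0' v hv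
    have := h2 v hv
    omega

noncomputable def transport (a : ℝ) (P : MvPolynomial (Fin 6) ℝ) : MvPolynomial (Fin 6) ℝ :=
  ∑ k, fieldPoly a k * pderiv k P

theorem transport_eq (a : ℝ) (P : MvPolynomial (Fin 6) ℝ) : transport a P =
    C 2 * (X 2 * (X 4 * pderiv 0 P)) + (C (-4) * (X 1 * (X 5 * pderiv 0 P)) +
    (C (-2) * (X 2 * (X 3 * pderiv 1 P)) + (C 4 * (X 0 * (X 5 * pderiv 1 P)) +
    (C 2 * (X 1 * (X 3 * pderiv 2 P)) + (C (-2) * (X 0 * (X 4 * pderiv 2 P)) +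
    (C (-2) * (X 4 * (X 5 * pderiv 3 P)) + (C 2 * (X 3 * (X 5 * pderiv 4 P)) +
    C a * (C (-1) * (X 2 * pderiv 4 P) + X 1 * pderiv 5 P)))))))) := by
  have h2 : (C 2 : MvPolynomial (Fin 6) ℝ) = 2 := map_ofNat C 2
  have h4 : (C 4 : MvPolynomial (Fin 6) ℝ) = 4 := map_ofNat C 4
  simp only [transport, Fin.sum_univ_six, fieldPoly, map_neg, h2, h4, map_one]
  simp
  ring

theorem coeff_transport (a : ℝ) (P : MvPolynomial (Fin 6) ℝ) {r : ℕ} (hr : r ∈ monomials 6 4) :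
    coeff (exponent r) (transport a P) = quadSum (fun e => coeff (exponent e) P) r +
      a * linSum (fun e => coeff (exponent e) P) r := by
  have Q : ∀ x ∈ quadTerms, ∀ i j k : Fin 6, x.2.1 = i → x.2.2.1 = j → x.1 = k →
      coeff (exponent r) (X i * (X j * pderiv k P)) = if digit r i = 0 then 0 else
      if digit r j = 0 then 0 else ((digit r k : ℝ) + 1) *
        coeff (exponent (r - 5 ^ (i : ℕ) - 5 ^ (j : ℕ) + 5 ^ (k : ℕ))) P := by
    intro x hx i j k hi hj hk
    obtain ⟨-, -, -, h1, h2, h3⟩ := quadTerms_distinct x hx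
    have h4 := digit_quad r hr x hx
    rw [hi, hj, hk] at *
    exact coeff_X_mul_X_mul_pderiv hr (fun h => h1 (congrArg _ h)) (fun h => h2 (congrArg _ h))
      (fun h => h3 (congrArg _ h)) P h4
  have L : ∀ x ∈ linTerms, ∀ i k : Fin 6, x.2.1 = i → x.1 = k →
      coeff (exponent r) (X i * pderiv k P) = if digit r i = 0 then 0 else
      ((digit r k : ℝ) + 1) * coeff (exponent (r - 5 ^ (i : ℕ) + 5 ^ (k : ℕ))) P := by
    intro x hx i k hi hk
    obtain ⟨-, -, h1⟩ := linTerms_distinct x hx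
    have h4 := digit_lin r hr x hx
    rw [hi, hk] at *
    exact coeff_X_mul_pderiv hr (fun h => h1 (congrArg _ h)) P h4
  rw [transport_eq]
  simp only [coeff_add, coeff_C_mul]
  rw [Q (0, 2, 4, 2) (by decide) 2 4 0 rfl rfl rfl, Q (0, 1, 5, -4) (by decide) 1 5 0 rfl rfl rfl,
    Q (1, 2, 3, -2) (by decide) 2 3 1 rfl rfl rfl, Q (1, 0, 5, 4) (by decide) 0 5 1 rfl rfl rfl,
    Q (2, 1, 3, 2) (by decide) 1 3 2 rfl rfl rfl, Q (2, 0, 4, -2) (by decide) 0 4 2 rfl rfl rfl,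
    Q (3, 4, 5, -2) (by decide) 4 5 3 rfl rfl rfl, Q (4, 3, 5, 2) (by decide) 3 5 4 rfl rfl rfl,
    L (4, 2, -1) (by decide) 2 4 rfl rfl, L (5, 1, 1) (by decide) 1 5 rfl rfl]
  simp only [quadSum, linSum, quadTerms, linTerms, List.map_cons, List.map_nil, List.sum_cons,
    List.sum_nil, mul_ite, mul_zero, mul_add a]
  norm_num
  ring_nf

/-- The Lie derivative along the Kovalevskaya field on families of polynomial components. -/
noncomputable def polyLie (a : ℝ) (q : ℕ) : ((Fin q → Fin 6) → MvPolynomial (Fin 6) ℝ) →ₗ[ℝ]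
    ((Fin q → Fin 6) → MvPolynomial (Fin 6) ℝ) where
  toFun p K := transport a (p K) +
    ∑ s, ∑ m, pderiv (K s) (fieldPoly a m) * p (Function.update K s m)
  map_add' p p' := by
    funext K
    simp only [transport, Pi.add_apply, map_add, mul_add, Finset.sum_add_distrib]
    ring
  map_smul' c p := by
    funext K
    simp only [transport, Pi.smul_apply, Derivation.map_smul, mul_smul_comm, ← Finset.smul_sum,
      smul_add, RingHom.id_apply]

theorem polyLie_apply (a : ℝ) (q : ℕ) (p : (Fin q → Fin 6) → MvPolynomial (Fin 6) ℝ)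
    (K : Fin q → Fin 6) : polyLie a q p K = transport a (p K) +
    ∑ s, ∑ m, pderiv (K s) (fieldPoly a m) * p (Function.update K s m) := rfl

/-- The coordinate function `xᵢ` as a polynomial; the code `6` stands for the constant `a`. -/
noncomputable def factorPoly (a : ℝ) (i : ℕ) : MvPolynomial (Fin 6) ℝ :=
  if h : i < 6 then X ⟨i, h⟩ else C a

/-- This certifies the table `slotTerms` against the Jacobian of the field, one row for each of the
six coordinates. -/
theorem sum_pderiv_fieldPoly (a : ℝ) {d : ℕ} (hd : d < 6)
    (P : Fin 6 → MvPolynomial (Fin 6) ℝ) :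
    ∑ m, pderiv (⟨5 - d, by omega⟩ : Fin 6) (fieldPoly a m) * P m =
      ((slotTerms d).map fun x => x.2.2 • (factorPoly a x.2.1 * P ⟨5 - x.1, by omega⟩)).sum := by
  have h2 : ∀ i : Fin 6, pderiv i (2 : MvPolynomial (Fin 6) ℝ) = 0 := fun i => by
    rw [← map_ofNat C 2, pderiv_C]
  have h4 : ∀ i : Fin 6, pderiv i (4 : MvPolynomial (Fin 6) ℝ) = 0 := fun i => by
    rw [← map_ofNat C 4, pderiv_C]
  have h0 : ∀ i j : Fin 6, i ≠ j → pderiv i (X j : MvPolynomial (Fin 6) ℝ) = 0 := fun i j h =>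
    pderiv_X_of_ne h.symm
  interval_cases d <;>
  · simp [Fin.sum_univ_six, fieldPoly, slotTerms, factorPoly, h2, h4, pderiv_X]
    try ring

theorem slotTerms_lt : ∀ d < 6, ∀ x ∈ slotTerms d, x.1 < 6 ∧ x.2.1 ≤ 6 := by decide

theorem slot_replace {q : ℕ} (hq : q = 2 ∨ q = 3) : ∀ J < 6 ^ q, ∀ s < q, ∀ d < 6, ∀ s' < q,
    slot (J - slot J s * 6 ^ s + d * 6 ^ s) s' = if s' = s then d else slot J s' := by
  rcases hq with rfl | rfl <;> decide +kernel

theorem update_slotIndex {q : ℕ} (hq : q = 2 ∨ q = 3) {J : ℕ} (hJ : J < 6 ^ q) (s : Fin q)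
    {d : ℕ} (hd : d < 6) : Function.update (slotIndex q J) s ⟨5 - d, by omega⟩ =
      slotIndex q (J - slot J s * 6 ^ (s : ℕ) + d * 6 ^ (s : ℕ)) := by
  funext s'
  have := slot_replace hq J hJ s s.2 d hd s' s'.2
  by_cases h : s' = s
  · subst h
    rw [Function.update_self]
    simp only [slotIndex, this, if_true]
  · rw [Function.update_of_ne h]
    simp only [slotIndex, this, if_neg fun h' => h (Fin.ext h')]

theorem sum_slotList {A : Type*} [AddCommMonoid A] (g : ℕ × ℤ × ℕ → A) (J n : ℕ) :
    ((slotList J n).map g).sum = ∑ s ∈ Finset.range n, ((slotTerms (slot J s)).map fun x =>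
      g (x.2.1, x.2.2, J - slot J s * 6 ^ s + x.1 * 6 ^ s)).sum := by
  induction n with
  | zero => rfl
  | succ n ih =>
    rw [Finset.sum_range_succ, ← ih, slotList, List.map_append, List.sum_append, List.map_map,
      add_comm]
    rfl

theorem sum_slots {q : ℕ} (hq : q = 2 ∨ q = 3) (a : ℝ) {J : ℕ} (hJ : J < 6 ^ q)
    (p : (Fin q → Fin 6) → MvPolynomial (Fin 6) ℝ) :
    ∑ s, ∑ m, pderiv (slotIndex q J s) (fieldPoly a m) * p (Function.update (slotIndex q J) s m) =
      ((slotList J q).map fun x => x.2.1 • (factorPoly a x.1 * p (slotIndex q x.2.2))).sum := by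
  rw [sum_slotList, Finset.sum_range]
  refine Finset.sum_congr rfl fun s _ => ?_
  rw [show slotIndex q J s = ⟨5 - slot J s, by omega⟩ from rfl,
    sum_pderiv_fieldPoly a (slot_lt J s) fun m => p (Function.update (slotIndex q J) s m)]
  refine congrArg List.sum (List.map_congr_left fun x hx => ?_)
  rw [update_slotIndex hq hJ s (slotTerms_lt _ (slot_lt J s) x hx).1]

theorem coeff_factorPoly_mul {a : ℝ} {r : ℕ} (hr : r ∈ monomials 6 4) {i : ℕ} (hi : i ≤ 6)
    (P : MvPolynomial (Fin 6) ℝ) : coeff (exponent r) (factorPoly a i * P) =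
      (if i = 6 then a else 1) * shifted (fun e => coeff (exponent e) P) r i := by
  rw [factorPoly, shifted]
  by_cases h : i < 6
  · rw [dif_pos h, if_neg (by omega), if_neg (by omega), one_mul, coeff_X_mul_exponent hr]
  · rw [dif_neg h, if_pos (by omega), if_pos (by omega), coeff_C_mul]

theorem slotList_le {J n : ℕ} : ∀ x ∈ slotList J n, x.1 ≤ 6 := by
  induction n with
  | zero => intro x hx; cases hx
  | succ n ih =>
    intro x hx
    rcases List.mem_append.1 hx with h | h
    · obtain ⟨y, hy, rfl⟩ := List.mem_map.1 h
      exact (slotTerms_lt _ (slot_lt J n) y hy).2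
    · exact ih x h

theorem coeff_polyLie {q : ℕ} (hq : q = 2 ∨ q = 3) (a : ℝ) {J : ℕ} (hJ : J < 6 ^ q)
    (p : (Fin q → Fin 6) → MvPolynomial (Fin 6) ℝ) {r : ℕ} (hr : r ∈ monomials 6 4)
    {ρ : ℕ → ℕ → ℝ} (hρ : ∀ J e, ρ J e = coeff (exponent e) (p (slotIndex q J))) :
    coeff (exponent r) (polyLie a q p (slotIndex q J)) =
      quadSum (ρ J) r + a * linSum (ρ J) r + ((slotList J q).map fun x =>
        x.2.1 • ((if x.1 = 6 then a else 1) * shifted (ρ x.2.2) r x.1)).sum := by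
  obtain rfl : ρ = fun J e => coeff (exponent e) (p (slotIndex q J)) :=
    funext fun J => funext fun e => hρ J e
  rw [polyLie_apply, coeff_add, coeff_transport a _ hr, sum_slots hq a hJ]
  congr 1
  rw [← coeffAddMonoidHom_apply, map_list_sum, List.map_map]
  refine congrArg List.sum (List.map_congr_left fun x hx => ?_)
  rw [Function.comp_apply, map_zsmul, coeffAddMonoidHom_apply,
    coeff_factorPoly_mul hr (slotList_le x hx)]

/-! ### Removing the parameter `a` -/

/-- The number of factors `γᵢ` of a monomial. -/
def gammaDegree (e : ℕ) : ℕ := digit e 0 + digit e 1 + digit e 2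

/-- The number of slots that carry an index of some `γᵢ`. -/
def gammaSlots : ℕ → ℕ → ℕ
  | 0, _ => 0
  | q + 1, J => gammaSlots q J + if 3 ≤ slot J q then 1 else 0

theorem gammaDegree_quad : ∀ r ∈ monomials 6 4, ∀ x ∈ quadTerms, digit r x.2.1 ≠ 0 →
    digit r x.2.2.1 ≠ 0 →
    gammaDegree (r - 5 ^ x.2.1 - 5 ^ x.2.2.1 + 5 ^ x.1) = gammaDegree r := by
  decide +kernel

theorem gammaDegree_lin : ∀ r ∈ monomials 6 4, ∀ x ∈ linTerms, digit r x.2.1 ≠ 0 →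
    gammaDegree (r - 5 ^ x.2.1 + 5 ^ x.1) + 1 = gammaDegree r := by
  decide +kernel

theorem gammaDegree_shift : ∀ r ∈ monomials 6 4, ∀ i < 6, digit r i ≠ 0 →
    gammaDegree (r - 5 ^ i) + (if i < 3 then 1 else 0) = gammaDegree r := by
  decide +kernel

theorem gammaSlots_slotList {q : ℕ} (hq : q = 2 ∨ q = 3) : ∀ J < 6 ^ q, ∀ x ∈ slotList J q,
    gammaSlots q x.2.2 + (if x.1 = 6 then 1 else 0) =
      gammaSlots q J + if x.1 < 3 then 1 else 0 := by
  rcases hq with rfl | rfl <;> decide +kernel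

/-- The field is the one for `a = 1` written in the coordinates `aγ, M`. In these coordinates each
`γᵢ` in a monomial and each `dγᵢ` in a slot contributes a factor `a`, so the equations for `ρ` are
those for `τ` up to a power of `a`. -/
theorem scaled_equation {q : ℕ} (hq : q = 2 ∨ q = 3) {a : ℝ} {ρ τ : ℕ → ℕ → ℝ}
    (h : ∀ J < 6 ^ q, ∀ e ∈ monomials 6 4,
      ρ J e = a ^ (gammaSlots q J + gammaDegree e) * τ J e)
    {J : ℕ} (hJ : J < 6 ^ q) {r : ℕ} (hr : r ∈ monomials 6 4) :
    quadSum (ρ J) r + a * linSum (ρ J) r + ((slotList J q).map fun x =>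
        x.2.1 • ((if x.1 = 6 then a else 1) * shifted (ρ x.2.2) r x.1)).sum =
      a ^ (gammaSlots q J + gammaDegree r) *
        (quadSum (τ J) r + linSum (τ J) r + slotSum τ q J r) := by
  rw [mul_add, mul_add]
  congr 1
  · congr 1
    · rw [quadSum, quadSum, ← List.sum_map_mul_left]
      refine congrArg List.sum (List.map_congr_left fun x hx => ?_)
      split_ifs with h1 h2
      · rw [mul_zero]
      · rw [mul_zero]
      · rw [h J hJ _ ((mem_monomials le_rfl).2 (quad_target r hr x hx h1 h2).1),
          gammaDegree_quad r hr x hx h1 h2, mul_smul_comm]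
    · rw [linSum, linSum, ← List.sum_map_mul_left, ← List.sum_map_mul_left]
      refine congrArg List.sum (List.map_congr_left fun x hx => ?_)
      split_ifs with h1
      · rw [mul_zero, mul_zero]
      · rw [h J hJ _ ((mem_monomials le_rfl).2 (lin_target r hr x hx h1).1),
          ← gammaDegree_lin r hr x hx h1, mul_smul_comm, mul_smul_comm, ← add_assoc, pow_succ]
        congr 1; ring
  · rw [slotSum, ← List.sum_map_mul_left]
    refine congrArg List.sum (List.map_congr_left fun x hx => ?_)
    rw [mul_smul_comm]
    congr 1
    have h1 := gammaSlots_slotList hq J hJ x hx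
    have h2 := (slotsHomogeneous hq J hJ x hx).1
    have h3 := slotList_le x hx
    rw [shifted, shifted]
    by_cases h6 : x.1 = 6
    · rw [if_pos h6, if_pos h6, if_pos h6, h _ h2 _ hr]
      rw [if_pos h6, if_neg (by omega)] at h1
      rw [show gammaSlots q J = gammaSlots q x.2.2 + 1 by omega, add_right_comm, pow_succ]
      ring
    · rw [if_neg h6, if_neg h6, if_neg h6, one_mul]
      rw [if_neg h6, add_zero] at h1
      split_ifs with h0
      · rw [mul_zero]
      · rw [h _ h2 _ ((mem_monomials le_rfl).2 (shift_target r hr x.1 (by omega) h0).1), h1,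
          ← gammaDegree_shift r hr x.1 (by omega) h0, add_assoc,
          add_comm (ite _ _ _) (gammaDegree _)]

theorem degree_exponent : ∀ e ∈ monomials 6 4, isMonomial 6 3 e = false →
    3 < digit e 0 + digit e 1 + digit e 2 + digit e 3 + digit e 4 + digit e 5 := by
  decide +kernel

theorem isMonomial_succ {v d x y : ℕ} (hx : x < 5) (hd : x ≤ d)
    (h : isMonomial v (d - x) y = true) : isMonomial (v + 1) d (x + 5 * y) = true := by
  rw [isMonomial, show (x + 5 * y) % 5 = x by omega, show (x + 5 * y) / 5 = y by omega, h,
    Bool.and_true]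
  exact decide_eq_true hd

theorem exists_exponent_eq {m : Fin 6 →₀ ℕ} (hm : m.degree ≤ 3) :
    ∃ e ∈ monomials 6 3, exponent e = m := by
  have h : m 0 + m 1 + m 2 + m 3 + m 4 + m 5 ≤ 3 := by
    rwa [Finsupp.degree_eq_sum, Fin.sum_univ_six] at hm
  refine ⟨m 0 + 5 * (m 1 + 5 * (m 2 + 5 * (m 3 + 5 * (m 4 + 5 * (m 5 + 5 * 0))))),
    (mem_monomials (by norm_num)).2 ?_, ?_⟩
  · repeat' refine isMonomial_succ (by omega) (by omega) ?_
    simp only [isMonomial, beq_iff_eq]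
  · ext i
    rw [exponent_apply]
    change (m 0 + 5 * (m 1 + 5 * (m 2 + 5 * (m 3 + 5 * (m 4 + 5 * (m 5 + 5 * 0)))))) /
      5 ^ (i : ℕ) % 5 = m i
    fin_cases i <;> simp <;> omega

theorem exists_slotIndex_eq {q : ℕ} (hq : q = 2 ∨ q = 3) (K : Fin q → Fin 6) :
    ∃ J < 6 ^ q, slotIndex q J = K := by
  rcases hq with rfl | rfl
  · refine ⟨(5 - K 0) + 6 * (5 - K 1), by omega, funext fun s => Fin.ext ?_⟩
    change 5 - ((5 - K 0) + 6 * (5 - K 1) : ℕ) / 6 ^ (s : ℕ) % 6 = K s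
    fin_cases s <;> simp <;> omega
  · refine ⟨(5 - K 0) + 6 * ((5 - K 1) + 6 * (5 - K 2)), by omega, funext fun s => Fin.ext ?_⟩
    change 5 - ((5 - K 0) + 6 * ((5 - K 1) + 6 * (5 - K 2)) : ℕ) / 6 ^ (s : ℕ) % 6 = K s
    fin_cases s <;> simp <;> omega

/-- The coefficients of `p`, divided by the scaling weights, solve the system for `a = 1`. Equations
up to degree 4 occur because the field is quadratic and the components are cubic. -/
theorem eq_zero_of_polyLie {q : ℕ} (hq : q = 2 ∨ q = 3) {a : ℝ} (ha : a ≠ 0)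
    {p : (Fin q → Fin 6) → MvPolynomial (Fin 6) ℝ} (hp : ∀ K, (p K).totalDegree ≤ 3)
    (hL : polyLie a q p = 0)
    (hn : ∀ x ∈ normals q, coeff (exponent x.2) (p (slotIndex q x.1)) = 0) : p = 0 := by
  let ρ : ℕ → ℕ → ℝ := fun J e => coeff (exponent e) (p (slotIndex q J))
  let w : ℕ → ℕ → ℝ := fun J e => a ^ (gammaSlots q J + gammaDegree e)
  have hw : ∀ J e, w J e ≠ 0 := fun J e => pow_ne_zero _ ha
  let τ : ℕ → ℕ → ℝ := fun J e => if J < 6 ^ q ∧ e ∈ monomials 6 3 then ρ J e / w J e else 0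
  have hτ : ∀ J < 6 ^ q, ∀ e ∈ monomials 6 4, ρ J e = w J e * τ J e := by
    intro J hJ e he
    by_cases h : e ∈ monomials 6 3
    · simp only [τ, if_pos (And.intro hJ h), mul_div_cancel₀ _ (hw J e)]
    · simp only [τ, if_neg fun h' => h (And.right h'), mul_zero]
      refine coeff_eq_zero_of_totalDegree_lt (lt_of_le_of_lt (hp _) ?_)
      have h1 := degree_exponent e he (by
        rwa [mem_monomials (by norm_num), Bool.not_eq_true] at h)
      rw [← Finsupp.degree_apply, Finsupp.degree_eq_sum, Fin.sum_univ_six]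
      exact h1
  have hS : System q τ :=
    { eqn := fun J hJ r hr => by
        have h1 := coeff_polyLie hq a hJ p hr (ρ := ρ) fun _ _ => rfl
        rw [hL, scaled_equation hq hτ hJ hr, Pi.zero_apply, coeff_zero] at h1
        exact (mul_eq_zero.1 h1.symm).resolve_left (hw J r)
      supp := fun J e h => if_neg h
      normal := fun x hx => by
        simp only [τ, ρ, hn x hx, zero_div, ite_self] }
  have h0 := hS.eq_zero hq
  funext K
  ext m
  rw [Pi.zero_apply, coeff_zero]
  by_cases hm : m.degree ≤ 3
  · obtain ⟨J, hJ, rfl⟩ := exists_slotIndex_eq hq K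
    obtain ⟨e, he, rfl⟩ := exists_exponent_eq hm
    have h1 := hτ J hJ e ((mem_monomials le_rfl).2 (monomials_mono e he))
    rwa [h0, Pi.zero_apply, Pi.zero_apply, mul_zero] at h1
  · exact coeff_eq_zero_of_totalDegree_lt (lt_of_le_of_lt (hp K) (by
      rw [← Finsupp.degree_apply]; omega))

/-! ### The known solutions and the normalisation -/

/-- The quadratic first integrals `f₁, f₂, f₃` as polynomials. -/
noncomputable def integralPoly (a : ℝ) : Fin 3 → MvPolynomial (Fin 6) ℝ :=
  ![X 0 ^ 2 + X 1 ^ 2 + X 2 ^ 2, X 0 * X 3 + X 1 * X 4 + X 2 * X 5,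
    X 3 ^ 2 + X 4 ^ 2 + 2 * X 5 ^ 2 + C a * X 0]

/-- The components of `df_{i₁} ⊗ ⋯ ⊗ df_{i_q}`. -/
noncomputable def productPoly (a : ℝ) {q : ℕ} (I : Fin q → Fin 3) (K : Fin q → Fin 6) :
    MvPolynomial (Fin 6) ℝ := ∏ s, pderiv (K s) (integralPoly a (I s))

/-- The derivatives of `f₁, f₂, f₃` by `γ₂, γ₃, M₁` form a matrix with diagonal `2γ₂, M₃, 2M₁`,
whose other entries are divisible by `γ₁`, `γ₃` or `M₂`. Modulo these three variables it is
diagonal, which makes the pivot coefficients independent. -/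
def pivotIndex : Fin 3 → Fin 6 := ![1, 2, 3]

def pivotVar : Fin 3 → Fin 6 := ![1, 5, 3]

def pivotCoeff : Fin 3 → ℝ := ![2, 1, 2]

theorem totalDegree_pderiv_le {σ : Type*} (p : MvPolynomial σ ℝ) {i : σ} {d : ℕ}
    (hp : p.totalDegree ≤ d + 1) : (pderiv i p).totalDegree ≤ d := by
  refine Finset.sup_le fun m hm => ?_
  rw [mem_support_iff, coeff_pderiv] at hm
  have h1 : (m + Finsupp.single i 1).degree ≤ p.totalDegree :=
    le_totalDegree (mem_support_iff.2 (left_ne_zero_of_mul hm))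
  rw [map_add, Finsupp.degree_single] at h1
  exact Nat.le_of_succ_le_succ (h1.trans hp)

theorem totalDegree_integralPoly_le (a : ℝ) (i : Fin 3) : (integralPoly a i).totalDegree ≤ 2 := by
  have hX : ∀ i : Fin 6, (X i : MvPolynomial (Fin 6) ℝ).totalDegree ≤ 1 := fun i =>
    (totalDegree_X i).le
  have hX2 : ∀ i : Fin 6, (X i ^ 2 : MvPolynomial (Fin 6) ℝ).totalDegree ≤ 2 := fun i =>
    (totalDegree_X_pow i 2).le
  have hXX : ∀ i j : Fin 6, (X i * X j : MvPolynomial (Fin 6) ℝ).totalDegree ≤ 2 := fun i j =>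
    (totalDegree_mul _ _).trans (Nat.add_le_add (hX i) (hX j))
  have hC : ∀ (c : ℝ) (p : MvPolynomial (Fin 6) ℝ), p.totalDegree ≤ 2 →
      (C c * p).totalDegree ≤ 2 := fun c p h =>
    (totalDegree_mul _ _).trans (by rwa [totalDegree_C, zero_add])
  have hadd : ∀ p p' : MvPolynomial (Fin 6) ℝ, p.totalDegree ≤ 2 → p'.totalDegree ≤ 2 →
      (p + p').totalDegree ≤ 2 := fun p p' h h' => (totalDegree_add _ _).trans (max_le h h')
  have h2 := hC 2 (X 5 ^ 2) (hX2 5)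
  rw [map_ofNat] at h2
  fin_cases i
  · exact hadd _ _ (hadd _ _ (hX2 0) (hX2 1)) (hX2 2)
  · exact hadd _ _ (hadd _ _ (hXX 0 3) (hXX 1 4)) (hXX 2 5)
  · exact hadd _ _ (hadd _ _ (hadd _ _ (hX2 3) (hX2 4)) h2)
      (hC a _ ((hX 0).trans one_le_two))

theorem totalDegree_productPoly_le (a : ℝ) {q : ℕ} (I : Fin q → Fin 3) (K : Fin q → Fin 6) :
    (productPoly a I K).totalDegree ≤ q := by
  refine (totalDegree_finsetProd _ _).trans ((Finset.sum_le_card_nsmul _ _ 1 fun s _ =>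
    totalDegree_pderiv_le _ (totalDegree_integralPoly_le a _)).trans ?_)
  simp

theorem pderiv_two (i : Fin 6) : pderiv i (2 : MvPolynomial (Fin 6) ℝ) = 0 := by
  rw [← map_ofNat C 2, pderiv_C]

theorem pderiv_pivotIndex_self (a : ℝ) (i : Fin 3) :
    pderiv (pivotIndex i) (integralPoly a i) = monomial (Finsupp.single (pivotVar i) 1)
      (pivotCoeff i) := by
  rw [← mul_one (pivotCoeff i), ← C_mul_monomial]
  change _ = C _ * X _
  have h2 : (C 2 : MvPolynomial (Fin 6) ℝ) = 2 := map_ofNat C 2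
  fin_cases i <;> simp [pivotIndex, pivotVar, pivotCoeff, integralPoly, pderiv_X, h2,
    pderiv_two]

theorem pderiv_pivotIndex_of_ne (a : ℝ) {i i' : Fin 3} (h : i ≠ i') :
    ∃ (v : Fin 6) (P : MvPolynomial (Fin 6) ℝ), (∀ j, pivotVar j ≠ v) ∧
      pderiv (pivotIndex i') (integralPoly a i) = X v * P := by
  have hv : ∀ v : Fin 6, v = 0 ∨ v = 2 ∨ v = 4 → ∀ j, pivotVar j ≠ v := by decide
  have hz : ∃ (v : Fin 6) (P : MvPolynomial (Fin 6) ℝ), (∀ j, pivotVar j ≠ v) ∧ 0 = X v * P :=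
    ⟨0, 0, hv 0 (by decide), by simp⟩
  fin_cases i <;> fin_cases i' <;> first | exact absurd rfl h | skip
  · exact ⟨2, 2, hv 2 (by decide), by
      simp [pivotIndex, integralPoly, pderiv_X, mul_comm]⟩
  · exact ⟨0, 0, hv 0 (by decide), by
      simp [pivotIndex, integralPoly, pderiv_X]⟩
  · exact ⟨4, 1, hv 4 (by decide), by
      simp [pivotIndex, integralPoly, pderiv_X]⟩
  · exact ⟨0, 1, hv 0 (by decide), by
      simp [pivotIndex, integralPoly, pderiv_X]⟩
  · exact ⟨0, 0, hv 0 (by decide), by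
      simp [pivotIndex, integralPoly, pderiv_X, pderiv_two]⟩
  · exact ⟨0, 0, hv 0 (by decide), by
      simp [pivotIndex, integralPoly, pderiv_X, pderiv_two]⟩

/-- If `I` and `I'` differ in a slot, the factor from that slot is off the diagonal, hence divisible
by a variable that the pivot monomial does not contain. -/
theorem coeff_productPoly (a : ℝ) {q : ℕ} (I I' : Fin q → Fin 3) :
    coeff (∑ s, Finsupp.single (pivotVar (I' s)) 1) (productPoly a I (pivotIndex ∘ I')) =
      if I = I' then ∏ s, pivotCoeff (I s) else 0 := by
  split_ifs with h
  · subst h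
    rw [productPoly, Finset.prod_congr rfl fun s _ =>
      show pderiv ((pivotIndex ∘ I) s) _ = _ from pderiv_pivotIndex_self a (I s),
      ← monomial_sum_prod, coeff_monomial, if_pos rfl]
  · obtain ⟨s, hs⟩ := Function.ne_iff.1 h
    obtain ⟨v, P, hv, hP⟩ := pderiv_pivotIndex_of_ne a hs
    rw [productPoly, ← Finset.mul_prod_erase _ _ (Finset.mem_univ s), Function.comp_apply, hP,
      mul_assoc, coeff_X_mul', if_neg]
    rw [Finsupp.mem_support_iff, not_not, Finsupp.finsetSum_apply]
    exact Finset.sum_eq_zero fun s' _ => Finsupp.single_eq_of_ne (hv _).symm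

/-- This matches the numeric codes of the normalised coefficients with the pivot components and
pivot monomials. -/
theorem normals_spec {q : ℕ} (hq : q = 2 ∨ q = 3) : ∀ x ∈ normals q, ∃ I : Fin q → Fin 3,
    (∀ s, slotIndex q x.1 s = pivotIndex (I s)) ∧
      ∀ i : Fin 6, digit x.2 i = ∑ s, if pivotVar (I s) = i then 1 else 0 := by
  rcases hq with rfl | rfl <;> decide +kernel

/-- The coefficients `c` are read off from the pivot coefficients of `p`; the difference is then a
normalised solution. It is still cubic because the products have degree at most `q ≤ 3`. -/
theorem exists_eq_sum_productPoly {q : ℕ} (hq : q = 2 ∨ q = 3) {a : ℝ} (ha : a ≠ 0)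
    (hI : ∀ I : Fin q → Fin 3, polyLie a q (productPoly a I) = 0)
    {p : (Fin q → Fin 6) → MvPolynomial (Fin 6) ℝ} (hp : ∀ K, (p K).totalDegree ≤ 3)
    (hL : polyLie a q p = 0) :
    ∃ c : (Fin q → Fin 3) → ℝ, p = ∑ I, c I • productPoly a I := by
  let c : (Fin q → Fin 3) → ℝ := fun I =>
    coeff (∑ s, Finsupp.single (pivotVar (I s)) 1) (p (pivotIndex ∘ I)) / ∏ s, pivotCoeff (I s)
  refine ⟨c, sub_eq_zero.1 (eq_zero_of_polyLie hq ha (fun K => ?_) ?_ fun x hx => ?_)⟩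
  · rw [Pi.sub_apply, Finset.sum_apply]
    refine (totalDegree_sub _ _).trans (max_le (hp K) (totalDegree_finsetSum_le fun I _ => ?_))
    rw [Pi.smul_apply]
    exact (totalDegree_smul_le _ _).trans ((totalDegree_productPoly_le a I K).trans (by omega))
  · rw [map_sub, hL, map_sum, zero_sub, neg_eq_zero]
    exact Finset.sum_eq_zero fun I _ => by rw [map_smul, hI, smul_zero]
  · obtain ⟨I, h1, h2⟩ := normals_spec hq x hx
    have e1 : slotIndex q x.1 = pivotIndex ∘ I := funext h1
    have e2 : exponent x.2 = ∑ s, Finsupp.single (pivotVar (I s)) 1 := by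
      ext i
      rw [exponent_apply, h2, Finsupp.finsetSum_apply]
      exact Finset.sum_congr rfl fun s _ => (Finsupp.single_apply).symm
    have h3 : ∏ s, pivotCoeff (I s) ≠ 0 := by
      refine Finset.prod_ne_zero_iff.2 fun s _ => ?_
      generalize I s = i
      fin_cases i <;> simp [pivotCoeff]
    rw [e1, e2, Pi.sub_apply, Finset.sum_apply, coeff_sub, coeff_sum]
    simp only [Pi.smul_apply, coeff_smul, coeff_productPoly, smul_eq_mul, mul_ite, mul_zero,
      Finset.sum_ite_eq', Finset.mem_univ, if_true, c]
    rw [div_mul_cancel₀ _ h3, sub_self]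

/-! ### Partial derivatives and the Lie derivative -/

section Calculus
variable {n : ℕ}

theorem fderiv_apply_eq_sum (f : (Fin n → ℝ) → ℝ) (x v : Fin n → ℝ) :
    fderiv ℝ f x v = ∑ k, v k * partialDeriv k f x := by
  conv_lhs => rw [← Finset.univ_sum_single v]
  rw [map_sum]
  refine Finset.sum_congr rfl fun k _ => ?_
  rw [partialDeriv, ← smul_eq_mul, ← map_smul, ← Pi.single_smul, smul_eq_mul, mul_one]

theorem partialDeriv_sum {ι : Type*} (s : Finset ι) {f : ι → (Fin n → ℝ) → ℝ} {x : Fin n → ℝ}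
    (hf : ∀ i ∈ s, DifferentiableAt ℝ (f i) x) (k : Fin n) :
    partialDeriv k (fun y => ∑ i ∈ s, f i y) x = ∑ i ∈ s, partialDeriv k (f i) x := by
  rw [partialDeriv, fderiv_fun_sum hf, sum_apply]
  rfl

theorem partialDeriv_add {f g : (Fin n → ℝ) → ℝ} {x : Fin n → ℝ} (hf : DifferentiableAt ℝ f x)
    (hg : DifferentiableAt ℝ g x) (k : Fin n) :
    partialDeriv k (fun y => f y + g y) x = partialDeriv k f x + partialDeriv k g x := by
  rw [partialDeriv, fderiv_fun_add hf hg]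
  rfl

theorem partialDeriv_mul {f g : (Fin n → ℝ) → ℝ} {x : Fin n → ℝ} (hf : DifferentiableAt ℝ f x)
    (hg : DifferentiableAt ℝ g x) (k : Fin n) :
    partialDeriv k (fun y => f y * g y) x = f x * partialDeriv k g x + partialDeriv k f x * g x := by
  rw [partialDeriv, fderiv_fun_mul hf hg]
  simp only [add_apply, smul_apply, smul_eq_mul,
    partialDeriv]
  ring

theorem partialDeriv_const (c : ℝ) (x : Fin n → ℝ) (k : Fin n) :
    partialDeriv k (fun _ => c) x = 0 := by
  simp [partialDeriv]

theorem partialDeriv_const_mul {f : (Fin n → ℝ) → ℝ} {x : Fin n → ℝ}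
    (hf : DifferentiableAt ℝ f x) (c : ℝ) (k : Fin n) :
    partialDeriv k (fun y => c * f y) x = c * partialDeriv k f x := by
  rw [partialDeriv_mul (differentiableAt_const c) hf, partialDeriv_const, zero_mul, add_zero]

theorem partialDeriv_coord (i k : Fin n) (x : Fin n → ℝ) :
    partialDeriv k (fun y => y i) x = (Pi.single k 1 : Fin n → ℝ) i := by
  rw [partialDeriv, (hasFDerivAt_apply i x).fderiv]
  rfl

theorem partialDeriv_prod {ι : Type*} [DecidableEq ι] (s : Finset ι) {f : ι → (Fin n → ℝ) → ℝ}
    {x : Fin n → ℝ} (hf : ∀ i ∈ s, DifferentiableAt ℝ (f i) x) (k : Fin n) :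
    partialDeriv k (fun y => ∏ i ∈ s, f i y) x =
      ∑ i ∈ s, (∏ j ∈ s.erase i, f j x) * partialDeriv k (f i) x := by
  rw [partialDeriv, fderiv_finsetProd hf, sum_apply]
  rfl

theorem differentiable_partialDeriv {f : (Fin n → ℝ) → ℝ} (hf : ContDiff ℝ 2 f) (k : Fin n) :
    Differentiable ℝ (partialDeriv k f) :=
  ((hf.fderiv_right (m := 1) (by norm_num)).clm_apply contDiff_const).differentiable one_ne_zero

theorem partialDeriv_comm {f : (Fin n → ℝ) → ℝ} (hf : ContDiff ℝ 2 f) (j k : Fin n)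
    (x : Fin n → ℝ) :
    partialDeriv j (partialDeriv k f) x = partialDeriv k (partialDeriv j f) x := by
  have hd : DifferentiableAt ℝ (fderiv ℝ f) x :=
    (hf.fderiv_right (m := 1) (by norm_num)).differentiable one_ne_zero x
  have e : ∀ i l : Fin n, partialDeriv i (partialDeriv l f) x =
      fderiv ℝ (fderiv ℝ f) x (Pi.single i 1) (Pi.single l 1) := by
    intro i l
    have := fderiv_clm_apply hd (differentiableAt_const (Pi.single l (1 : ℝ) : Fin n → ℝ))
    change fderiv ℝ (fun y => fderiv ℝ f y (Pi.single l 1)) x _ = _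
    rw [this]
    simp
  rw [e, e]
  exact (hf.contDiffAt.isSymmSndFDerivAt (by simp)).eq _ _

/-- The differential of a first integral of a vector field is an invariant 1-form. -/
theorem lieDeriv_differential {X : (Fin n → ℝ) → (Fin n → ℝ)}
    (hX : ∀ k, Differentiable ℝ fun y => X y k) {h : (Fin n → ℝ) → ℝ} (hh : ContDiff ℝ 2 h)
    (h0 : ∀ x, ∑ k, X x k * partialDeriv k h x = 0) (j : Fin n) (x : Fin n → ℝ) :
    ∑ k, X x k * partialDeriv k (partialDeriv j h) x +
      ∑ m, partialDeriv j (fun y => X y m) x * partialDeriv m h x = 0 := by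
  -- The identity is the `j`-th derivative of `Xh = 0`, with the second derivatives of `h`
  -- interchanged.
  have h1 : partialDeriv j (fun y => ∑ k, X y k * partialDeriv k h y) x = 0 := by
    rw [funext h0, partialDeriv_const]
  rw [partialDeriv_sum (f := fun k y => X y k * partialDeriv k h y) _ fun k _ =>
    (hX k x).fun_mul (differentiable_partialDeriv hh k x)] at h1
  rw [← h1, ← Finset.sum_add_distrib]
  refine Finset.sum_congr rfl fun k _ => ?_
  rw [partialDeriv_mul (hX k x) (differentiable_partialDeriv hh k x), partialDeriv_comm hh]

theorem differentiable_tensorDiff {q : ℕ} {G : Fin q → (Fin n → ℝ) → ℝ}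
    (hG : ∀ s, ContDiff ℝ 2 (G s)) (J : Fin q → Fin n) : Differentiable ℝ (tensorDiff G J) :=
  fun x =>
  (HasFDerivAt.finsetProd (u := Finset.univ) (g := fun s x => partialDeriv (J s) (G s) x)
    fun s _ => (differentiable_partialDeriv (hG s) (J s) x).hasFDerivAt).differentiableAt

/-- By the Leibniz rule the Lie derivative is a sum over the slots. The summand of slot `s` is the
product of the other factors times the Lie derivative of `dG_s`, which vanishes. -/
theorem isInvariant_tensorDiff {X : (Fin n → ℝ) → (Fin n → ℝ)}
    (hX : ∀ k, Differentiable ℝ fun y => X y k) {q : ℕ} {G : Fin q → (Fin n → ℝ) → ℝ}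
    (hG : ∀ s, ContDiff ℝ 2 (G s)) (h0 : ∀ s x, ∑ k, X x k * partialDeriv k (G s) x = 0) :
    IsInvariant X (tensorDiff G) := by
  intro J x
  have e1 : ∀ k, partialDeriv k (tensorDiff G J) x = ∑ s,
      (∏ t ∈ Finset.univ.erase s, partialDeriv (J t) (G t) x) *
        partialDeriv k (partialDeriv (J s) (G s)) x := fun k =>
    partialDeriv_prod _ (fun s _ => differentiable_partialDeriv (hG s) (J s) x) k
  have e2 : ∀ s m, tensorDiff G (Function.update J s m) x =
      (∏ t ∈ Finset.univ.erase s, partialDeriv (J t) (G t) x) * partialDeriv m (G s) x := by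
    intro s m
    rw [tensorDiff, ← Finset.prod_erase_mul _ _ (Finset.mem_univ s), Function.update_self]
    congr 1
    refine Finset.prod_congr rfl fun t ht => ?_
    rw [Function.update_of_ne (Finset.ne_of_mem_erase ht)]
  rw [lieDeriv]
  simp only [e1, e2, Finset.mul_sum]
  rw [Finset.sum_comm, ← Finset.sum_add_distrib]
  refine Finset.sum_eq_zero fun s _ => ?_
  have h1 := lieDeriv_differential hX (hG s) (h0 s) (J s) x
  rw [← mul_zero (∏ t ∈ Finset.univ.erase s, partialDeriv (J t) (G t) x), ← h1, mul_add,
    Finset.mul_sum, Finset.mul_sum]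
  congr 1 <;> exact Finset.sum_congr rfl fun _ _ => by ring

theorem lieDeriv_add {q : ℕ} (X : (Fin n → ℝ) → (Fin n → ℝ)) {T U : CovTensorField n q}
    (hT : ∀ J, Differentiable ℝ (T J)) (hU : ∀ J, Differentiable ℝ (U J)) :
    lieDeriv X (T + U) = lieDeriv X T + lieDeriv X U := by
  funext J x
  have e : ∀ k, partialDeriv k ((T + U) J) x = partialDeriv k (T J) x + partialDeriv k (U J) x :=
    partialDeriv_add (hT J x) (hU J x)
  simp only [lieDeriv, e]
  simp only [lieDeriv, Pi.add_apply, mul_add, Finset.sum_add_distrib]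
  ring

theorem lieDeriv_smul {q : ℕ} (X : (Fin n → ℝ) → (Fin n → ℝ)) {T : CovTensorField n q}
    (hT : ∀ J, Differentiable ℝ (T J)) (c : ℝ) : lieDeriv X (c • T) = c • lieDeriv X T := by
  funext J x
  have e : ∀ k, partialDeriv k ((c • T) J) x = c * partialDeriv k (T J) x :=
    partialDeriv_const_mul (hT J x) c
  simp only [lieDeriv, e]
  simp only [lieDeriv, Pi.smul_apply, smul_eq_mul, mul_add, Finset.mul_sum]
  congr 1
  · exact Finset.sum_congr rfl fun _ _ => by ring
  · exact Finset.sum_congr rfl fun _ _ => Finset.sum_congr rfl fun _ _ => by ring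

end Calculus

section Polynomial
variable {n : ℕ}

theorem contDiff_eval (p : MvPolynomial (Fin n) ℝ) : ContDiff ℝ ∞ fun x => eval x p := by
  induction p using MvPolynomial.induction_on with
  | C c => simpa using contDiff_const
  | add p p' h h' => simpa using h.add h'
  | mul_X p i h => simpa using h.mul (contDiff_apply ℝ ℝ i)

theorem differentiable_eval (p : MvPolynomial (Fin n) ℝ) : Differentiable ℝ fun x => eval x p :=
  (contDiff_eval p).differentiable (by simp)

theorem partialDeriv_eval (p : MvPolynomial (Fin n) ℝ) (k : Fin n) (x : Fin n → ℝ) :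
    partialDeriv k (fun y => eval y p) x = eval x (pderiv k p) := by
  induction p using MvPolynomial.induction_on with
  | C c => simp [partialDeriv_const]
  | add p p' h h' =>
    simp only [map_add, ← h, ← h']
    exact partialDeriv_add (differentiable_eval p x) (differentiable_eval p' x) k
  | mul_X p i h =>
    have e := partialDeriv_mul (differentiable_eval p x) (differentiable_eval (X i) x) k
    simp only [← map_mul] at e
    rw [e, h]
    simp only [eval_X, partialDeriv_coord, Derivation.leibniz, smul_eq_mul, map_add, map_mul,
      pderiv_X]
    rw [Pi.single_apply, Pi.single_apply]
    split_ifs <;> simp [mul_comm]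

end Polynomial

/-! ### The first integrals and their invariant products -/

theorem eval_fieldPoly (a : ℝ) (x : Fin 6 → ℝ) (k : Fin 6) :
    eval x (fieldPoly a k) = field a x k := by
  fin_cases k <;> simp [fieldPoly, field]

theorem eval_integralPoly (a : ℝ) (x : Fin 6 → ℝ) (i : Fin 3) :
    eval x (integralPoly a i) = integrals a x (i.castSucc) := by
  fin_cases i <;> simp [integralPoly, integrals]

theorem differentiable_field (a : ℝ) (k : Fin 6) : Differentiable ℝ fun y => field a y k := by
  simp only [← eval_fieldPoly]
  exact differentiable_eval _

theorem lieDeriv_eval (a : ℝ) {q : ℕ} (p : (Fin q → Fin 6) → MvPolynomial (Fin 6) ℝ)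
    (K : Fin q → Fin 6) (x : Fin 6 → ℝ) :
    lieDeriv (field a) (fun K x => eval x (p K)) K x = eval x (polyLie a q p K) := by
  simp only [lieDeriv, polyLie_apply, transport, map_add, map_sum, map_mul, partialDeriv_eval,
    eval_fieldPoly, ← partialDeriv_eval (fieldPoly _ _)]

theorem isInvariant_eval_iff (a : ℝ) {q : ℕ} (p : (Fin q → Fin 6) → MvPolynomial (Fin 6) ℝ) :
    IsInvariant (field a) (fun K x => eval x (p K)) ↔ polyLie a q p = 0 := by
  constructor
  · intro h
    funext K
    refine MvPolynomial.funext fun x => ?_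
    rw [← lieDeriv_eval, h, Pi.zero_apply, map_zero]
  · intro h K x
    rw [lieDeriv_eval, h, Pi.zero_apply, map_zero]

theorem contDiff_integrals (a : ℝ) : ContDiff ℝ ∞ (integrals a) := by
  refine contDiff_pi.2 fun i => ?_
  fin_cases i <;> simp only [integrals] <;> simp <;> fun_prop

theorem exists_transport_eq_zero (a : ℝ) (i : Fin 4) : ∃ F : MvPolynomial (Fin 6) ℝ,
    (∀ x, eval x F = integrals a x i) ∧ transport a F = 0 := by
  have h4 : ∀ i : Fin 6, pderiv i (4 : MvPolynomial (Fin 6) ℝ) = 0 := fun i => by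
    rw [← map_ofNat C 4, pderiv_C]
  fin_cases i
  · refine ⟨X 0 ^ 2 + X 1 ^ 2 + X 2 ^ 2, fun x => by simp [integrals], ?_⟩
    simp [transport, Fin.sum_univ_six, fieldPoly, pderiv_X]
    ring
  · refine ⟨X 0 * X 3 + X 1 * X 4 + X 2 * X 5, fun x => by simp [integrals], ?_⟩
    simp [transport, Fin.sum_univ_six, fieldPoly, pderiv_X]
    ring
  · refine ⟨X 3 ^ 2 + X 4 ^ 2 + 2 * X 5 ^ 2 + C a * X 0, fun x => by simp [integrals], ?_⟩
    simp [transport, Fin.sum_univ_six, fieldPoly, pderiv_X, pderiv_two]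
    ring
  · refine ⟨(X 3 ^ 2 - X 4 ^ 2 - C a * X 0) ^ 2 + (2 * X 3 * X 4 - C a * X 1) ^ 2,
      fun x => by simp [integrals], ?_⟩
    simp [transport, Fin.sum_univ_six, fieldPoly, pderiv_X, pderiv_two]
    ring

theorem fderiv_integrals_field (a : ℝ) (x : Fin 6 → ℝ) :
    fderiv ℝ (integrals a) x (field a x) = 0 := by
  have hd : ∀ i, DifferentiableAt ℝ (fun x => integrals a x i) x := fun i =>
    (contDiff_pi.1 (contDiff_integrals a) i).differentiable (by simp) x
  rw [show integrals a = fun x i => integrals a x i from rfl, fderiv_pi hd]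
  ext i
  change fderiv ℝ (fun x => integrals a x i) x (field a x) = 0
  rw [fderiv_apply_eq_sum]
  obtain ⟨F, h1, h2⟩ := exists_transport_eq_zero a i
  simp only [← h1, partialDeriv_eval, ← eval_fieldPoly, ← map_mul, ← map_sum]
  exact (congrArg (eval x) h2).trans (map_zero _)

theorem sum_field_mul_partialDeriv (a : ℝ) {g : (Fin 4 → ℝ) → ℝ} (hg : ContDiff ℝ 2 g)
    (x : Fin 6 → ℝ) :
    ∑ k, field a x k * partialDeriv k (fun x => g (integrals a x)) x = 0 := by
  rw [← fderiv_apply_eq_sum]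
  have h := fderiv_comp x (hg.differentiable two_ne_zero (integrals a x))
    ((contDiff_integrals a).differentiable (by simp) x)
  change fderiv ℝ (g ∘ integrals a) x _ = 0
  rw [h, ContinuousLinearMap.comp_apply, fderiv_integrals_field, map_zero]

theorem contDiff_comp_integrals (a : ℝ) {g : (Fin 4 → ℝ) → ℝ} (hg : ContDiff ℝ 2 g) :
    ContDiff ℝ 2 fun x => g (integrals a x) :=
  hg.comp ((contDiff_infty.1 (contDiff_integrals a) 2))

theorem isInvariant_tensorDiff_integrals (a : ℝ) {q : ℕ} {g : Fin q → (Fin 4 → ℝ) → ℝ}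
    (hg : ∀ s, ContDiff ℝ 2 (g s)) :
    IsInvariant (field a) (tensorDiff fun s x => g s (integrals a x)) :=
  isInvariant_tensorDiff (differentiable_field a) (fun s => contDiff_comp_integrals a (hg s))
    fun s x => sum_field_mul_partialDeriv a (hg s) x

theorem isInvariant_of_mem_span (a : ℝ) {q : ℕ} {T : CovTensorField 6 q}
    (hT : T ∈ Submodule.span ℝ (invariantProducts a q)) : IsInvariant (field a) T := by
  -- Differentiability of the components is carried through the induction, because linearity of the
  -- Lie derivative is available only for differentiable components.
  suffices h : (∀ J, Differentiable ℝ (T J)) ∧ lieDeriv (field a) T = 0 from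
    fun J x => congrFun (congrFun h.2 J) x
  induction hT using Submodule.span_induction with
  | mem T h =>
    obtain ⟨g, hg, rfl⟩ := h
    have hg' : ∀ s, ContDiff ℝ 2 (g s) := fun s => contDiff_infty.1 (hg s) 2
    exact ⟨differentiable_tensorDiff fun s => contDiff_comp_integrals a (hg' s),
      funext fun J => funext fun x => isInvariant_tensorDiff_integrals a hg' J x⟩
  | zero =>
    refine ⟨fun J => differentiable_const 0, funext fun J => funext fun x => ?_⟩
    simp [lieDeriv, partialDeriv]
  | add T U _ _ h h' =>
    exact ⟨fun J => (h.1 J).add (h'.1 J), by rw [lieDeriv_add _ h.1 h'.1, h.2, h'.2, add_zero]⟩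
  | smul c T _ h =>
    exact ⟨fun J => (h.1 J).const_smul c, by rw [lieDeriv_smul _ h.1, h.2, smul_zero]⟩

/-- The tensor product of the differentials of the quadratic integrals with indices `I`. -/
noncomputable def productTensor (a : ℝ) {q : ℕ} (I : Fin q → Fin 3) : CovTensorField 6 q :=
  tensorDiff fun s x => integrals a x (I s).castSucc

theorem productTensor_eq_eval (a : ℝ) {q : ℕ} (I : Fin q → Fin 3) :
    productTensor a I = fun K x => eval x (productPoly a I K) := by
  funext K x
  simp only [productTensor, tensorDiff, productPoly, map_prod, ← partialDeriv_eval,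
    eval_integralPoly]

theorem productTensor_mem (a : ℝ) {q : ℕ} (I : Fin q → Fin 3) :
    productTensor a I ∈ invariantProducts a q :=
  ⟨fun s y => y (I s).castSucc, fun _ => contDiff_apply ℝ ℝ _, rfl⟩

/-- This is stronger than membership in the span: constant coefficients and the three quadratic
integrals suffice, which is what the antisymmetric case uses. -/
theorem exists_eq_sum_productTensor {q : ℕ} (hq : q = 2 ∨ q = 3) {a : ℝ} (ha : a ≠ 0)
    {T : CovTensorField 6 q} (hT : HasCubicComponents T) (hL : IsInvariant (field a) T) :
    ∃ c : (Fin q → Fin 3) → ℝ, T = ∑ I, c I • productTensor a I := by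
  choose p hp hTp using hT
  obtain rfl : T = fun K x => eval x (p K) := funext fun K => funext fun x => hTp K x
  have hI : ∀ I : Fin q → Fin 3, polyLie a q (productPoly a I) = 0 := fun I => by
    rw [← isInvariant_eval_iff, ← productTensor_eq_eval]
    exact isInvariant_of_mem_span a (Submodule.subset_span (productTensor_mem a I))
  obtain ⟨c, rfl⟩ := exists_eq_sum_productPoly hq ha hI hp ((isInvariant_eval_iff a p).1 hL)
  refine ⟨c, funext fun K => funext fun x => ?_⟩
  simp only [Finset.sum_apply, Pi.smul_apply, map_sum, smul_eval, productTensor_eq_eval,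
    smul_eq_mul]

theorem isInvariant_iff_mem_span {q : ℕ} (hq : q = 2 ∨ q = 3) {a : ℝ} (ha : a ≠ 0)
    {T : CovTensorField 6 q} (hT : HasCubicComponents T) :
    IsInvariant (field a) T ↔ T ∈ Submodule.span ℝ (invariantProducts a q) := by
  refine ⟨fun h => ?_, isInvariant_of_mem_span a⟩
  obtain ⟨c, rfl⟩ := exists_eq_sum_productTensor hq ha hT h
  exact Submodule.sum_mem _ fun I _ => Submodule.smul_mem _ _
    (Submodule.subset_span (productTensor_mem a I))

/-! ### Antisymmetric solutions are single exterior products -/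

/-- The function `∑ᵢ cᵢ yᵢ` of the first three coordinates of `ℝ⁴`. -/
def linearCombination (c : Fin 3 → ℝ) (y : Fin 4 → ℝ) : ℝ := ∑ i, c i * y i.castSucc

theorem contDiff_linearCombination (c : Fin 3 → ℝ) : ContDiff ℝ ∞ (linearCombination c) := by
  unfold linearCombination; fun_prop

theorem partialDeriv_linearCombination (a : ℝ) (c : Fin 3 → ℝ) (k : Fin 6) (x : Fin 6 → ℝ) :
    partialDeriv k (fun x => linearCombination c (integrals a x)) x =
      ∑ i, c i * partialDeriv k (fun x => integrals a x i.castSucc) x := by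
  have hd : ∀ i, DifferentiableAt ℝ (fun x => integrals a x i) x := fun i =>
    (contDiff_pi.1 (contDiff_integrals a) i).differentiable (by simp) x
  unfold linearCombination
  rw [partialDeriv_sum _ fun i _ => (hd _).const_mul (c i)]
  exact Finset.sum_congr rfl fun i _ => partialDeriv_const_mul (hd _) _ _

theorem sum_productTensor_apply (a : ℝ) {q : ℕ} (c : (Fin q → Fin 3) → ℝ) (K : Fin q → Fin 6)
    (x : Fin 6 → ℝ) : (∑ I, c I • productTensor a I) K x =
      ∑ I, c I * ∏ s, partialDeriv (K s) (fun x => integrals a x (I s).castSucc) x := by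
  simp only [Finset.sum_apply, Pi.smul_apply, smul_eq_mul]
  rfl

/-- Summing `sign σ • T (K ∘ σ)` over all permutations gives `q!` times `T` by antisymmetry, and
turns each tensor product into a determinant. -/
theorem factorial_mul_sum_productTensor (a : ℝ) {q : ℕ} (c : (Fin q → Fin 3) → ℝ)
    (hT : IsAlternating (∑ I, c I • productTensor a I)) (K : Fin q → Fin 6) (x : Fin 6 → ℝ) :
    (Nat.factorial q : ℝ) * (∑ I, c I • productTensor a I) K x =
      ∑ I, c I * Matrix.det (Matrix.of fun s t =>
        partialDeriv (K s) (fun x => integrals a x (I t).castSucc) x) := by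
  have h1 : ∀ σ : Equiv.Perm (Fin q), ((Equiv.Perm.sign σ : ℤ) : ℝ) *
      (∑ I, c I • productTensor a I) (K ∘ σ) x = (∑ I, c I • productTensor a I) K x := by
    intro σ
    rw [hT σ K x, ← mul_assoc, ← Int.cast_mul, ← Units.val_mul, Int.units_mul_self,
      Units.val_one, Int.cast_one, one_mul]
  have h2 := Finset.sum_congr rfl fun σ (_ : σ ∈ Finset.univ) => h1 σ
  rw [Finset.sum_const, Finset.card_univ, Fintype.card_perm, Fintype.card_fin,
    nsmul_eq_mul] at h2
  rw [← h2]
  simp only [Matrix.det_apply', Finset.mul_sum, sum_productTensor_apply]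
  rw [Finset.sum_comm]
  refine Finset.sum_congr rfl fun I _ => Finset.sum_congr rfl fun σ _ => ?_
  simp only [Function.comp_apply, Matrix.of_apply]
  ring

/-- Only the differences `b i j = c ![i, j] - c ![j, i]` matter. They form a 2-vector in dimension
3, which is always decomposable as `u ∧ v`; linear combinations of the integrals with coefficients
`u` and `v` then serve as functions. -/
theorem exists_wedgeDiff_two (a : ℝ) (c : (Fin 2 → Fin 3) → ℝ)
    (hT : IsAlternating (∑ I, c I • productTensor a I)) :
    ∃ g : Fin 2 → (Fin 4 → ℝ) → ℝ, (∀ s, ContDiff ℝ ∞ (g s)) ∧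
      ∑ I, c I • productTensor a I = wedgeDiff fun s x => g s (integrals a x) := by
  suffices h : ∃ u v : Fin 3 → ℝ, ∀ e e' : Fin 3 → ℝ,
      ∑ I : Fin 2 → Fin 3, c I * (e (I 0) * e' (I 1) - e (I 1) * e' (I 0)) =
      2 * ((∑ i, u i * e i) * (∑ i, v i * e' i) - (∑ i, v i * e i) * ∑ i, u i * e' i) by
    obtain ⟨u, v, h⟩ := h
    refine ⟨![linearCombination u, linearCombination v], fun s => ?_,
      funext fun K => funext fun x => ?_⟩
    · fin_cases s <;> exact contDiff_linearCombination _
    have h1 := factorial_mul_sum_productTensor a c hT K x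
    simp only [Matrix.det_fin_two, Matrix.of_apply] at h1
    rw [h (fun i => partialDeriv (K 0) (fun x => integrals a x i.castSucc) x)
      (fun i => partialDeriv (K 1) (fun x => integrals a x i.castSucc) x)] at h1
    rw [wedgeDiff, Matrix.det_fin_two]
    simp only [Matrix.of_apply, Matrix.cons_val_zero, Matrix.cons_val_one,
      partialDeriv_linearCombination]
    exact mul_left_cancel₀ two_ne_zero (by simpa using h1)
  have hs : ∀ f : (Fin 2 → Fin 3) → ℝ, ∑ I, f I = ∑ i, ∑ j, f ![i, j] := by
    intro f
    rw [← Fintype.sum_prod_type']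
    exact (Fintype.sum_equiv (finTwoArrowEquiv (Fin 3)).symm _ _ fun _ => rfl).symm
  -- If `b 0 1 = 0`, the index 2 splits off: `(b 0 2 e₀ + b 1 2 e₁) ∧ e₂`. Otherwise division by `b
  -- 0 1` gives `(b 0 1 e₀ - b 1 2 e₂) ∧ (e₁ + (b 0 2 / b 0 1) e₂)`. The halves in the witnesses
  -- compensate the factor `2!`.
  by_cases hb : c ![0, 1] - c ![1, 0] = 0
  · refine ⟨![(c ![0, 2] - c ![2, 0]) / 2, (c ![1, 2] - c ![2, 1]) / 2, 0], ![0, 0, 1],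
      fun e e' => ?_⟩
    rw [hs]
    simp only [Fin.sum_univ_three, Matrix.cons_val_zero, Matrix.cons_val_one, Matrix.cons_val]
    linear_combination (e 0 * e' 1 - e 1 * e' 0) * hb
  · refine ⟨![(c ![0, 1] - c ![1, 0]) / 2, 0, -(c ![1, 2] - c ![2, 1]) / 2],
      ![0, 1, (c ![0, 2] - c ![2, 0]) / (c ![0, 1] - c ![1, 0])], fun e e' => ?_⟩
    rw [hs]
    simp only [Fin.sum_univ_three, Matrix.cons_val_zero, Matrix.cons_val_one, Matrix.cons_val]
    field_simp
    ring

/-- `ε` is the sign of `I` when `I` is a permutation, and zero when two columns coincide. -/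
theorem exists_det_submatrix_eq (I : Fin 3 → Fin 3) : ∃ ε : ℝ, ∀ E : Matrix (Fin 3) (Fin 3) ℝ,
    (E.submatrix id I).det = ε * E.det := by
  by_cases h : Function.Injective I
  · let σ : Equiv.Perm (Fin 3) := Equiv.ofBijective I (Finite.injective_iff_bijective.1 h)
    exact ⟨_, fun E => Matrix.det_permute' σ E⟩
  · obtain ⟨i, j, h1, h2⟩ := Function.not_injective_iff.1 h
    refine ⟨0, fun E => ?_⟩
    rw [zero_mul]
    exact Matrix.det_zero_of_column_eq h2 fun k => by rw [Matrix.submatrix_apply,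
      Matrix.submatrix_apply, h1]

theorem exists_wedgeDiff_three (a : ℝ) (c : (Fin 3 → Fin 3) → ℝ)
    (hT : IsAlternating (∑ I, c I • productTensor a I)) :
    ∃ g : Fin 3 → (Fin 4 → ℝ) → ℝ, (∀ s, ContDiff ℝ ∞ (g s)) ∧
      ∑ I, c I • productTensor a I = wedgeDiff fun s x => g s (integrals a x) := by
  choose ε hε using exists_det_submatrix_eq
  -- All determinants are multiples of the one of `df₁, df₂, df₃`; the total factor, divided by `3!
  -- = 6`, is absorbed into the first function.
  refine ⟨![linearCombination ![(∑ I, c I * ε I) / 6, 0, 0], linearCombination ![0, 1, 0],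
    linearCombination ![0, 0, 1]], fun s => ?_, funext fun K => funext fun x => ?_⟩
  · fin_cases s <;> exact contDiff_linearCombination _
  have h1 := factorial_mul_sum_productTensor a c hT K x
  have h2 : ∀ I : Fin 3 → Fin 3, Matrix.det (Matrix.of fun s t : Fin 3 =>
        partialDeriv (K s) (fun x => integrals a x (I t).castSucc) x) =
      ε I * Matrix.det (Matrix.of fun s i : Fin 3 =>
        partialDeriv (K s) (fun x => integrals a x i.castSucc) x) := fun I =>
    hε I (Matrix.of fun s i : Fin 3 => partialDeriv (K s) (fun x => integrals a x i.castSucc) x)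
  rw [Finset.sum_congr rfl fun I _ => congrArg (c I * ·) (h2 I)] at h1
  simp only [← mul_assoc, ← Finset.sum_mul] at h1
  rw [show ((Nat.factorial 3 : ℕ) : ℝ) = 6 by norm_num [Nat.factorial]] at h1
  have h3 : (∑ I, c I • productTensor a I) K x = (∑ I, c I * ε I) / 6 *
      Matrix.det (Matrix.of fun s i : Fin 3 =>
        partialDeriv (K s) (fun x => integrals a x i.castSucc) x) := by
    linear_combination h1 / 6
  rw [h3, wedgeDiff, Matrix.det_fin_three, Matrix.det_fin_three]
  simp only [Matrix.of_apply, Matrix.cons_val_zero, Matrix.cons_val_one, Matrix.cons_val,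
    partialDeriv_linearCombination, Fin.sum_univ_three]
  ring

end Kovalevskaya

theorem proposition6 (a : ℝ) (ha : a ≠ 0) :
    -- the differential of every function of the first integrals is an invariant 1-form
    (∀ g : (Fin 4 → ℝ) → ℝ, ContDiff ℝ 2 g →
      Kovalevskaya.IsInvariant (Kovalevskaya.field a)
        (Kovalevskaya.tensorDiff fun (_ : Fin 1) x => g (Kovalevskaya.integrals a x))) ∧
    ∀ q : ℕ, q = 2 ∨ q = 3 →
      -- tensor products of such differentials are invariant
      (∀ g : Fin q → (Fin 4 → ℝ) → ℝ, (∀ s, ContDiff ℝ 2 (g s)) →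
        Kovalevskaya.IsInvariant (Kovalevskaya.field a)
          (Kovalevskaya.tensorDiff fun s x => g s (Kovalevskaya.integrals a x))) ∧
      -- the cubic solutions are exactly the cubic linear combinations of tensor products
      (∀ T : Kovalevskaya.CovTensorField 6 q, Kovalevskaya.HasCubicComponents T →
        (Kovalevskaya.IsInvariant (Kovalevskaya.field a) T ↔
          T ∈ Submodule.span ℝ (Kovalevskaya.invariantProducts a q))) ∧
      -- an antisymmetric cubic solution is a single exterior product
      (∀ T : Kovalevskaya.CovTensorField 6 q, Kovalevskaya.HasCubicComponents T →
        Kovalevskaya.IsAlternating T → Kovalevskaya.IsInvariant (Kovalevskaya.field a) T →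
          ∃ g : Fin q → (Fin 4 → ℝ) → ℝ, (∀ s, ContDiff ℝ ∞ (g s)) ∧
            T = Kovalevskaya.wedgeDiff fun s x => g s (Kovalevskaya.integrals a x)) := by
  refine ⟨fun g hg => Kovalevskaya.isInvariant_tensorDiff_integrals a fun _ => hg,
    fun q hq => ⟨fun g hg => Kovalevskaya.isInvariant_tensorDiff_integrals a hg,
      fun T hT => Kovalevskaya.isInvariant_iff_mem_span hq ha hT, fun T hT hA hL => ?_⟩⟩
  obtain ⟨c, rfl⟩ := Kovalevskaya.exists_eq_sum_productTensor hq ha hT hL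
  rcases hq with rfl | rfl
  · exact Kovalevskaya.exists_wedgeDiff_two a c hA
  · exact Kovalevskaya.exists_wedgeDiff_three a c hA
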